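/- For an integer $\mu\ge 0$ let $V^{0,\mu}$ be the Banach space $\ell^1(\mathbb N_0;\mathbb C)$ with norm $\|a\|_1=\sum_n|a_n|$, whose element $a$ represents the function $e^{i\mu\theta}\sum_n a_n Q^{0,\mu}_n(r)$ on the unit disk, where $Q^{0,\mu}_n(r)=r^{\mu}P^{0,\mu}_n(2r^2-1)$ are the radial Zernike polynomials ($P_n^{0,\mu}$ the Jacobi polynomials orthogonal for the weight $(1+x)^{\mu}$ on $[-1,1]$). For $U\in V^{0,\mu}$ let $G(U)=U*U\in V^{0,2\mu}$ be the sequence of Zernike coefficients of the square of the function represented by $U$. Let $\triangle_0^{-1}$ be the inverse Dirichlet Laplacian on the disk acting on Zernike coefficients: with $\mathcal Q_n=e^{i\mu\theta}Q_n^{0,\mu}$, $\triangle_0^{-1}\mathcal Q_0=\frac{\mathcal Q_1-\mathcal Q_0}{4(\mu+1)(\mu+2)}$ and, for $n\ge1$, $$\triangle_0^{-1}\mathcal Q_n=\frac{\mathcal Q_{n+1}}{4(2n+\mu+1)(2n+\mu+2)}-\frac{\mathcal Q_n}{2(2n+\mu+2)(2n+\mu)}+\frac{\mathcal Q_{n-1}}{4(2n+\mu)(2n+\mu+1)}.$$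 Let $(R^-)^m:V^{0,2m}\to V^{0,m}$ be multiplication by $\bar z^m$, and let $R^+_{0,1}$ be multiplication by $z$ from wave number $1$ to wave number $2$; for $f\in V^{0,2}$, $(R^+_{0,1})^{-1}f$ is the unique sequence $x$ with $\sum_n |x_n|/(2n+2)<\infty$ and $R^+_{0,1}x=f$. For an integer $m\ge-1$ define $F_m:V^{0,|m|}\to V^{0,|m|}$ by $$F_m(U)=U+\triangle_0^{-1}(R^-)^mG(U)\quad(m\ge0),\qquad F_{-1}(U)=U+\triangle_0^{-1}(R^+_{0,1})^{-1}G(U).$$ Let $N\ge1$, let $\pi^N$ be the projection keeping the coefficients with index $n\le N$, and $\pi^\infty=I-\pi^N$. Let $U_0\in V^{0,|m|}$, let $A^N$ be a bounded linear operator on $V^{0,|m|}$ with $A^N=\pi^NA^N\pi^N$, and put $A=A^N+\pi^\infty$. Write $\|\cdot\|_1$ also for the operator norm on $\ell^1$. Let $Z_2$ satisfy $$Z_2\ \ge\ \begin{cases}2\,\|A^N\triangle_0^{-1}(R^-)^m\pi^{N+1}\|_1+\dfrac{2}{(2(N+1)+m)^2}&\text{if } m\ge0,\\[2mm] 2\,\|A^N\triangle_0^{-1}(R^+_{0,1})^{-1}\pi^{N}\|_1+\dfrac{16}{15}\,\dfrac{\|A^N\|_1}{N+3}+\dfrac1{2N}&\text{if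 } m=-1.\end{cases}$$ Then $G$ and $F_m$ are well defined on $V^{0,|m|}$ with $U*U\in\ell^1$, $F_m$ is Fréchet differentiable, and for every $r$ and every $c$ in the closed ball $\overline{B_r(U_0)}$, $$\|A(DF_m(c)-DF_m(U_0))\|_1\le Z_2\,r.$$ -/

import Mathlib

open scoped ENNReal NNReal

noncomputable section

namespace ZernikeDisk

/-! ### Zernike polynomials -/

/-- The Jacobi polynomial `P_n^{k,m}` (weight `(1-x)^k (1+x)^m`), for integers `k, m ≥ 0`:
`∑ₛ C(n+k, n-s) C(n+m, s) ((x-1)/2)^s ((x+1)/2)^(n-s)`. -/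
def jacobi (k m n : ℕ) (x : ℝ) : ℝ :=
  ∑ s ∈ Finset.range (n + 1),
    ((n + k).choose (n - s) : ℝ) * ((n + m).choose s : ℝ)
      * ((x - 1) / 2) ^ s * ((x + 1) / 2) ^ (n - s)

/-- The radial Zernike polynomial `Q_n^{k,m}(r) = r^m P_n^{k,m}(2r² - 1)`, for `m ≥ 0`. -/
def radialZernike (k m n : ℕ) (r : ℝ) : ℝ :=
  r ^ m * jacobi k m n (2 * r ^ 2 - 1)

/-- The Banach space `V^{0,m}` with trivial weights, i.e. `ℓ¹(ℕ₀)` with complex entries: a sequence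
`a` stands for the function `e^{imθ} ∑ₙ aₙ Q_n^{0,m}(r)` on the disk.  The underlying space is the
same for all wave numbers `m`, which are therefore carried by the operators. -/
abbrev V : Type := lp (fun _ : ℕ => ℂ) 1

/-- The radial part `∑ₙ aₙ Q_n^{0,m}(r)` of the Zernike series of `a ∈ V^{0,m}`. -/
def series (m : ℕ) (a : V) (r : ℝ) : ℂ :=
  ∑' n, a n * (radialZernike 0 m n r : ℂ)

/-- The inverse transform: the `n`-th Zernike coefficient, with respect to the orthogonal
system `Q_n^{0,m}`, of the function `e^{imθ} u(r)` on the disk (area element `r dr dθ`). -/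
def zernikeCoeff (m : ℕ) (u : ℝ → ℂ) (n : ℕ) : ℂ :=
  (∫ r in (0 : ℝ)..1, u r * (radialZernike 0 m n r : ℂ) * (r : ℂ)) /
    ((∫ r in (0 : ℝ)..1, radialZernike 0 m n r ^ 2 * r : ℝ) : ℂ)

/-- The coefficients in `V^{0,m₁+m₂}` of the discrete convolution `a * b`, the product of the
functions represented by `a ∈ V^{0,m₁}` and `b ∈ V^{0,m₂}`. -/
def conv (m₁ m₂ : ℕ) (a b : V) : ℕ → ℂ :=
  zernikeCoeff (m₁ + m₂) (fun r => series m₁ a r * series m₂ b r)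

open Classical in
/-- The quadratic nonlinearity `G(U) = U * U`, `V^{0,m} → V^{0,2m}`.  The alternative `0` is never
taken, as the theorem asserts. -/
def G (m : ℕ) (U : V) : V :=
  if h : Memℓp (conv m m U U) 1 then ⟨conv m m U U, h⟩ else 0

/-! ### Linear operators on sequences of Zernike coefficients -/

/-- Multiplication by `z̄`, from wave number `m` to wave number `m - 1` (`m ≥ 1`):
`Q_n^{0,m} ↦ (n+1)/(2n+m+1) Q_{n+1}^{0,m-1} + (n+m)/(2n+m+1) Q_n^{0,m-1}`. -/
def RminusSeq (m : ℕ) : (ℕ → ℂ) →ₗ[ℂ] (ℕ → ℂ) where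
  toFun x
    | 0 => (m / (m + 1) : ℂ) * x 0
    | n + 1 => ((n + 1) / (2 * n + m + 1) : ℂ) * x n
        + ((n + 1 + m) / (2 * (n + 1) + m + 1) : ℂ) * x (n + 1)
  map_add' x y := by
    funext n; cases n <;> simp only [Pi.add_apply] <;> ring
  map_smul' c x := by
    funext n; cases n <;> simp only [Pi.smul_apply, smul_eq_mul, RingHom.id_apply] <;> ring

/-- Multiplication by `z`, from wave number `m` to wave number `m + 1` (`m ≥ 0`):
`Q_n^{0,m} ↦ (n+m+1)/(2n+m+1) Q_n^{0,m+1} + n/(2n+m+1) Q_{n-1}^{0,m+1}`. -/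
def RplusSeq (m : ℕ) : (ℕ → ℂ) →ₗ[ℂ] (ℕ → ℂ) where
  toFun x n := ((n + m + 1) / (2 * n + m + 1) : ℂ) * x n
    + ((n + 1) / (2 * (n + 1) + m + 1) : ℂ) * x (n + 1)
  map_add' x y := by
    funext n; simp only [Pi.add_apply]; ring
  map_smul' c x := by
    funext n; simp only [Pi.smul_apply, smul_eq_mul, RingHom.id_apply]; ring

/-- The inverse Dirichlet Laplacian at wave number `m`:
`Q_0^{0,m} ↦ (Q_1^{0,m} - Q_0^{0,m}) / (4(m+1)(m+2))` and, for `n ≥ 1`,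
`Q_n^{0,m} ↦ Q_{n+1}^{0,m} / (4(2n+m+1)(2n+m+2)) - Q_n^{0,m} / (2(2n+m+2)(2n+m))
  + Q_{n-1}^{0,m} / (4(2n+m)(2n+m+1))`. -/
def invLapSeq (m : ℕ) : (ℕ → ℂ) →ₗ[ℂ] (ℕ → ℂ) where
  toFun x
    | 0 => -(1 / (4 * (m + 1) * (m + 2)) : ℂ) * x 0
        + (1 / (4 * (2 + m) * (2 + m + 1)) : ℂ) * x 1
    | n + 1 => (1 / (4 * (2 * n + m + 1) * (2 * n + m + 2)) : ℂ) * x n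
        - (1 / (2 * (2 * (n + 1) + m + 2) * (2 * (n + 1) + m)) : ℂ) * x (n + 1)
        + (1 / (4 * (2 * (n + 2) + m) * (2 * (n + 2) + m + 1)) : ℂ) * x (n + 2)
  map_add' x y := by
    funext n; cases n <;> simp only [Pi.add_apply] <;> ring
  map_smul' c x := by
    funext n; cases n <;> simp only [Pi.smul_apply, smul_eq_mul, RingHom.id_apply] <;> ring

/-- The matrix of `(R⁺_{0,1})⁻¹`. -/
def invRplusEntry (i j : ℕ) : ℝ :=
  if i ≤ j then (-1) ^ (i + j) * (2 * (i + 1) ^ 2 / ((j + 1) * (j + 2))) else 0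

theorem abs_invRplusEntry_le (i j : ℕ) :
    |invRplusEntry i j| ≤ if i ≤ j then 2 * ((i : ℝ) + 1) / (j + 2) else 0 := by
  unfold invRplusEntry
  split_ifs with h
  · have hij : (i : ℝ) ≤ j := by exact_mod_cast h
    rw [abs_mul, abs_pow, abs_neg, abs_one, one_pow, one_mul, abs_of_nonneg (by positivity),
      div_le_div_iff₀ (by positivity) (by positivity)]
    have : (0 : ℝ) ≤ (j - i) * (2 * (i + 1) * (j + 2)) :=
      mul_nonneg (by linarith) (by positivity)
    nlinarith
  · simp

theorem abs_invRplusEntry_le' (i j : ℕ) : |invRplusEntry i j| ≤ 2 * ((i : ℝ) + 1) := by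
  refine (abs_invRplusEntry_le i j).trans ?_
  split_ifs
  · exact div_le_self (by positivity) (by linarith [(Nat.cast_nonneg j : (0 : ℝ) ≤ j)])
  · positivity

theorem summable_norm_V (x : V) : Summable fun n => ‖x n‖ := by
  have := (lp.memℓp x).summable (by simp)
  simpa using this

theorem summable_invRplus (f : V) (i : ℕ) :
    Summable fun j => (invRplusEntry i j : ℂ) * f j := by
  refine Summable.of_norm_bounded ((summable_norm_V f).mul_left (2 * ((i : ℝ) + 1))) fun j => ?_
  rw [norm_mul, Complex.norm_real, Real.norm_eq_abs]
  exact mul_le_mul_of_nonneg_right (abs_invRplusEntry_le' i j) (norm_nonneg _)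

/-- The operator `(R⁺_{0,1})⁻¹` from `V^{0,2}` to sequences; see `invRplusSeq_spec`. -/
def invRplusSeq : V →ₗ[ℂ] (ℕ → ℂ) where
  toFun f i := ∑' j, (invRplusEntry i j : ℂ) * f j
  map_add' f g := by
    funext i
    simp only [lp.coeFn_add, Pi.add_apply, mul_add]
    exact (summable_invRplus f i).tsum_add (summable_invRplus g i)
  map_smul' c f := by
    funext i
    simp only [lp.coeFn_smul, Pi.smul_apply, smul_eq_mul, RingHom.id_apply]
    rw [← tsum_mul_left]
    exact tsum_congr fun j => by ring

theorem enorm_invRplusSeq_tsum_le (f : V) :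
    ∑' i, ‖invRplusSeq f i‖ₑ * ENNReal.ofReal (1 / (2 * i + 2)) ≤ ∑' j, ‖f j‖ₑ := by
  have key : ∀ i, ‖invRplusSeq f i‖ₑ * ENNReal.ofReal (1 / (2 * i + 2)) ≤
      ∑' j, (if i ≤ j then ENNReal.ofReal (1 / (j + 2)) else 0) * ‖f j‖ₑ := by
    intro i
    have h1 : ‖invRplusSeq f i‖ₑ ≤ ∑' j, ‖(invRplusEntry i j : ℂ) * f j‖ₑ :=
      enorm_tsum_le_tsum_enorm
    refine (mul_le_mul_left h1 _).trans ?_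
    rw [← ENNReal.tsum_mul_right]
    refine ENNReal.tsum_le_tsum fun j => ?_
    rw [enorm_mul, mul_right_comm]
    refine mul_le_mul_left ?_ _
    have h2 := abs_invRplusEntry_le i j
    have h3 : ‖(invRplusEntry i j : ℂ)‖ₑ = ENNReal.ofReal |invRplusEntry i j| := by
      rw [← ofReal_norm, Complex.norm_real, Real.norm_eq_abs]
    rw [h3, ← ENNReal.ofReal_mul (abs_nonneg _)]
    split_ifs with h
    · rw [if_pos h] at h2
      refine ENNReal.ofReal_le_ofReal ?_
      calc |invRplusEntry i j| * (1 / (2 * i + 2)) ≤ (2 * ((i : ℝ) + 1) / (j + 2)) * (1 / (2 * i + 2)) :=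
            mul_le_mul_of_nonneg_right h2 (by positivity)
        _ = 1 / (j + 2) := by field_simp
    · rw [if_neg h] at h2
      have : |invRplusEntry i j| = 0 := le_antisymm h2 (abs_nonneg _)
      simp [this]
  refine (ENNReal.tsum_le_tsum key).trans ?_
  rw [ENNReal.tsum_comm]
  refine ENNReal.tsum_le_tsum fun j => ?_
  rw [ENNReal.tsum_mul_right]
  refine mul_le_of_le_one_left' ?_
  rw [tsum_eq_sum (s := Finset.range (j + 1)) (fun i hi => by
    rw [if_neg]; simpa using hi)]
  refine (Finset.sum_le_card_nsmul _ _ (ENNReal.ofReal (1 / (j + 2))) (fun i _ => ?_)).trans ?_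
  · split_ifs <;> simp
  · rw [Finset.card_range, nsmul_eq_mul, ← ENNReal.ofReal_natCast,
      ← ENNReal.ofReal_mul (by positivity), ← ENNReal.ofReal_one]
    refine ENNReal.ofReal_le_ofReal ?_
    rw [mul_one_div, div_le_one (by positivity)]
    push_cast; linarith

/-- `invRplusSeq f` is the unique `x` in the weighted space `V^{0,1}_{-1}` (norm
`∑ₙ |xₙ| / (2n+2)`) with `R⁺_{0,1} x = f`. -/
theorem invRplusSeq_spec (f : V) (x : ℕ → ℂ) :
    (Summable (fun n : ℕ => ‖x n‖ / (2 * n + 2)) ∧ RplusSeq 1 x = f) ↔ x = invRplusSeq f := by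
  have ex1 : Summable (fun n : ℕ => ‖invRplusSeq f n‖ / (2 * n + 2)) := by
    have hfin : ∑' j, ‖f j‖ₑ ≠ ⊤ := by
      have := (summable_norm_V f).tsum_ofReal_ne_top
      simpa [ofReal_norm] using this
    have h2 := ne_top_of_le_ne_top hfin (enorm_invRplusSeq_tsum_le f)
    have h3 := ENNReal.summable_toReal h2
    refine h3.congr fun n => ?_
    rw [ENNReal.toReal_mul, toReal_enorm, ENNReal.toReal_ofReal (by positivity), mul_one_div]
  have ex2 : RplusSeq 1 (invRplusSeq f) = f := by
    funext i
    change ((i + (1 : ℕ) + 1) / (2 * i + (1 : ℕ) + 1) : ℂ) * ∑' j, (invRplusEntry i j : ℂ) * f j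
      + ((i + 1) / (2 * (i + 1) + (1 : ℕ) + 1) : ℂ) * ∑' j, (invRplusEntry (i + 1) j : ℂ) * f j
      = f i
    rw [← tsum_mul_left, ← tsum_mul_left, ← Summable.tsum_add
      ((summable_invRplus f i).mul_left _) ((summable_invRplus f (i + 1)).mul_left _)]
    have hi1 : (i : ℂ) + 1 ≠ 0 := by exact_mod_cast (Nat.succ_ne_zero i)
    have hi2 : (i : ℂ) + 2 ≠ 0 := by exact_mod_cast (Nat.succ_ne_zero (i + 1))
    have e1 : (2 * i + (1 : ℕ) + 1 : ℂ) = 2 * (i + 1) := by push_cast; ring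
    have e2 : (2 * (i + 1) + (1 : ℕ) + 1 : ℂ) = 2 * (i + 2) := by push_cast; ring
    have e3 : (i + (1 : ℕ) + 1 : ℂ) = i + 2 := by push_cast; ring
    rw [tsum_eq_single i]
    · have h0 : invRplusEntry (i + 1) i = 0 := by simp [invRplusEntry]
      have h1 : (invRplusEntry i i : ℂ) = 2 * (i + 1) / (i + 2) := by
        simp only [invRplusEntry, le_refl, if_true]
        rw [← two_mul, pow_mul]
        push_cast
        field_simp
        ring
      rw [h0, h1, e1, e3]
      push_cast
      field_simp
      ring
    · intro j hj
      rcases lt_or_gt_of_ne hj with h | h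
      · have h0 : invRplusEntry i j = 0 := by simp [invRplusEntry, h]
        have h1 : invRplusEntry (i + 1) j = 0 := by
          simp only [invRplusEntry]; rw [if_neg (by omega)]
        simp [h0, h1]
      · have hj1 : (j : ℂ) + 1 ≠ 0 := by exact_mod_cast (Nat.succ_ne_zero j)
        have hj2 : (j : ℂ) + 2 ≠ 0 := by exact_mod_cast (Nat.succ_ne_zero (j + 1))
        have h0 : (invRplusEntry i j : ℂ)
            = (-1) ^ (i + j) * (2 * (i + 1) ^ 2 / ((j + 1) * (j + 2))) := by
          simp only [invRplusEntry]; rw [if_pos h.le]; push_cast; rfl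
        have h1 : (invRplusEntry (i + 1) j : ℂ)
            = -((-1) ^ (i + j) * (2 * (i + 2) ^ 2 / ((j + 1) * (j + 2)))) := by
          simp only [invRplusEntry]; rw [if_pos (by omega)]; push_cast; ring
        rw [h0, h1, e1, e2, e3]
        field_simp
        ring
  constructor
  · rintro ⟨hx, hRx⟩
    set d : ℕ → ℂ := x - invRplusSeq f with hd
    have hRd : RplusSeq 1 d = 0 := by rw [hd, map_sub, hRx, ex2, sub_self]
    have hform : ∀ n, d n = (-1) ^ n * (n + 1) ^ 2 * d 0 := by
      intro n
      induction n with
      | zero => simp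
      | succ n ih =>
        have h := congrFun hRd n
        change ((n + (1 : ℕ) + 1) / (2 * n + (1 : ℕ) + 1) : ℂ) * d n
          + ((n + 1) / (2 * (n + 1) + (1 : ℕ) + 1) : ℂ) * d (n + 1) = 0 at h
        have hi1 : (n : ℂ) + 1 ≠ 0 := by exact_mod_cast (Nat.succ_ne_zero n)
        have hi2 : (n : ℂ) + 2 ≠ 0 := by exact_mod_cast (Nat.succ_ne_zero (n + 1))
        have e1 : (2 * n + (1 : ℕ) + 1 : ℂ) = 2 * (n + 1) := by push_cast; ring
        have e2 : (2 * (n + 1) + (1 : ℕ) + 1 : ℂ) = 2 * (n + 2) := by push_cast; ring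
        have e3 : (n + (1 : ℕ) + 1 : ℂ) = n + 2 := by push_cast; ring
        rw [e1, e2, e3, ih] at h
        field_simp at h
        have h' : (n + 1 : ℂ) * (d (n + 1) - (-1) ^ (n + 1) * (n + 2) ^ 2 * d 0) = 0 := by
          rw [pow_succ (-1 : ℂ)]
          linear_combination h
        have h'' := (mul_eq_zero.mp h').resolve_left hi1
        push_cast
        linear_combination h''
    have hd0 : d 0 = 0 := by
      have hs : Summable (fun n : ℕ => ‖d n‖ / (2 * n + 2)) := by
        refine Summable.of_nonneg_of_le (fun n => by positivity) (fun n => ?_) (hx.add ex1)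
        rw [← add_div]
        exact div_le_div_of_nonneg_right (norm_sub_le _ _) (by positivity)
      have ht := hs.tendsto_atTop_zero
      have hle : ∀ n : ℕ, ‖d 0‖ / 2 ≤ ‖d n‖ / (2 * n + 2) := by
        intro n
        have hn : ‖(n : ℂ) + 1‖ = n + 1 := by
          have : ((n : ℂ) + 1) = ((n + 1 : ℕ) : ℂ) := by push_cast; rfl
          rw [this, Complex.norm_natCast]; push_cast; rfl
        rw [hform n, norm_mul, norm_mul, norm_pow, norm_pow, norm_neg, norm_one, one_pow, one_mul,
          hn, div_le_div_iff₀ (by positivity) (by positivity)]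
        have h0 := norm_nonneg (d 0)
        have hn0 : (0 : ℝ) ≤ n := Nat.cast_nonneg n
        nlinarith [mul_nonneg h0 hn0, mul_nonneg (mul_nonneg h0 hn0) hn0]
      have := ge_of_tendsto' ht hle
      have h0 := norm_nonneg (d 0)
      exact norm_eq_zero.mp (by linarith)
    have : d = 0 := by
      funext n; rw [hform n, hd0]; simp
    exact sub_eq_zero.mp this
  · rintro rfl
    exact ⟨ex1, ex2⟩

/-! ### Bounded operators -/

/-- A linear map from `ℓ¹` to sequences that is bounded in the `1`-norm, as a bounded operator. -/
def ofBounded (T : V →ₗ[ℂ] (ℕ → ℂ))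
    (hT : ∃ C : ℝ≥0, ∀ x : V, ∑' n, ‖T x n‖ₑ ≤ C * ∑' n, ‖x n‖ₑ) : V →L[ℂ] V :=
  have hfin : ∀ x : V, ∑' n, ‖x n‖ₑ = ENNReal.ofReal ‖x‖ := fun x => by
    rw [lp.norm_eq_tsum_rpow (by simp)]
    simp only [ENNReal.toReal_one, Real.rpow_one, div_one]
    rw [ENNReal.ofReal_tsum_of_nonneg (fun _ => norm_nonneg _) (summable_norm_V x)]
    simp [ofReal_norm]
  have hmem : ∀ x : V, Memℓp (T x) 1 := fun x => by
    obtain ⟨C, hC⟩ := hT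
    have h : ∑' n, ‖T x n‖ₑ ≠ ⊤ :=
      ne_top_of_le_ne_top (by rw [hfin]; finiteness) (hC x)
    have h' := ENNReal.summable_toReal h
    refine memℓp_gen ?_
    simpa using h'
  LinearMap.mkContinuousOfExistsBound
    { toFun := fun x => ⟨T x, hmem x⟩
      map_add' := fun x y => Subtype.ext (T.map_add x y)
      map_smul' := fun c x => Subtype.ext (T.map_smul c x) }
    (by
      obtain ⟨C, hC⟩ := hT
      refine ⟨C, fun x => ?_⟩
      have h := hC x
      have e : ∑' n, ‖T x n‖ₑ = ENNReal.ofReal ‖(⟨T x, hmem x⟩ : V)‖ := hfin ⟨T x, hmem x⟩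
      have h' : ENNReal.ofReal ‖(⟨T x, hmem x⟩ : V)‖ ≤ ENNReal.ofReal (C * ‖x‖) := by
        rw [← e, ENNReal.ofReal_mul (NNReal.coe_nonneg C), ENNReal.ofReal_coe_nnreal, ← hfin]
        exact h
      exact (ENNReal.ofReal_le_ofReal_iff (by positivity)).mp h')

theorem ofBounded_apply (T : V →ₗ[ℂ] (ℕ → ℂ)) (hT) (x : V) (n : ℕ) :
    ofBounded T hT x n = T x n := rfl

/-- The inclusion of `ℓ¹` into all sequences. -/
def toSeq : V →ₗ[ℂ] (ℕ → ℂ) where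
  toFun x := x
  map_add' _ _ := rfl
  map_smul' _ _ := rfl

theorem tsum_band_le (y : ℕ → ℂ) (g : ℕ → ℝ≥0∞) (h0 : ‖y 0‖ₑ ≤ g 0 + g 1)
    (h : ∀ n, ‖y (n + 1)‖ₑ ≤ g n + g (n + 1) + g (n + 2)) :
    ∑' n, ‖y n‖ₑ ≤ (3 : ℝ≥0) * ∑' n, g n := by
  have s1 : ∑' n, g n = g 0 + ∑' n, g (n + 1) := tsum_eq_zero_add' ENNReal.summable
  have s2 : ∑' n, g (n + 1) = g 1 + ∑' n, g (n + 2) := tsum_eq_zero_add' ENNReal.summable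
  have s3 : ∑' n, ‖y n‖ₑ = ‖y 0‖ₑ + ∑' n, ‖y (n + 1)‖ₑ := tsum_eq_zero_add' ENNReal.summable
  calc ∑' n, ‖y n‖ₑ = ‖y 0‖ₑ + ∑' n, ‖y (n + 1)‖ₑ := s3
    _ ≤ (g 0 + g 1) + ∑' n, (g n + g (n + 1) + g (n + 2)) :=
        add_le_add h0 (ENNReal.tsum_le_tsum h)
    _ = (g 0 + ∑' n, g (n + 1)) + (g 1 + ∑' n, g (n + 2)) + ∑' n, g n := by
        rw [ENNReal.tsum_add, ENNReal.tsum_add]; ring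
    _ ≤ ∑' n, g n + ∑' n, g n + ∑' n, g n := by
        rw [← s2, ← s1]
        have : ∑' n, g (n + 1) ≤ ∑' n, g n := by rw [s1]; exact le_add_self
        exact add_le_add_left (add_le_add_right this _) _
    _ = (3 : ℝ≥0) * ∑' n, g n := by push_cast; ring

theorem enorm_mul_le_of_real {a : ℂ} (c t : ℝ) (ha : a = (c : ℂ)) (h0 : 0 ≤ c) (h : c ≤ t)
    (x : ℂ) : ‖a * x‖ₑ ≤ ‖x‖ₑ * ENNReal.ofReal t := by
  have h1 : ‖a‖ₑ = ENNReal.ofReal c := by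
    rw [ha, ← ofReal_norm, Complex.norm_real, Real.norm_of_nonneg h0]
  rw [enorm_mul, h1, mul_comm]
  gcongr

theorem div_le_one_div_of {a b c : ℝ} (hb : 0 < b) (hc : 0 < c) (h : a * c ≤ b) :
    a / b ≤ 1 / c := by
  rw [div_le_div_iff₀ hb hc]; linarith

theorem RminusSeq_bounded (m : ℕ) :
    ∃ C : ℝ≥0, ∀ x : V, ∑' n, ‖(RminusSeq m ∘ₗ toSeq) x n‖ₑ ≤ C * ∑' n, ‖x n‖ₑ := by
  refine ⟨3, fun x => tsum_band_le _ (fun n => ‖x n‖ₑ) ?_ fun n => ?_⟩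
  · change ‖(m / (m + 1) : ℂ) * x 0‖ₑ ≤ _
    refine (enorm_mul_le_of_real (m / (m + 1)) 1 (by push_cast; rfl) (by positivity) ?_ _).trans ?_
    · rw [div_le_one (by positivity)]; linarith
    · simp
  · change ‖((n + 1) / (2 * n + m + 1) : ℂ) * x n
        + ((n + 1 + m) / (2 * (n + 1) + m + 1) : ℂ) * x (n + 1)‖ₑ ≤ _
    refine (enorm_add_le _ _).trans ?_
    refine le_add_right (add_le_add ?_ ?_)
    · refine (enorm_mul_le_of_real ((n + 1) / (2 * n + m + 1)) 1 (by push_cast; rfl)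
        (by positivity) ?_ _).trans (by simp)
      rw [div_le_one (by positivity)]
      linarith [(Nat.cast_nonneg n : (0 : ℝ) ≤ n), (Nat.cast_nonneg m : (0 : ℝ) ≤ m)]
    · refine (enorm_mul_le_of_real ((n + 1 + m) / (2 * (n + 1) + m + 1)) 1 (by push_cast; rfl)
        (by positivity) ?_ _).trans (by simp)
      rw [div_le_one (by positivity)]
      linarith [(Nat.cast_nonneg n : (0 : ℝ) ≤ n), (Nat.cast_nonneg m : (0 : ℝ) ≤ m)]

theorem invLapSeq_bound (m : ℕ) (w : ℕ → ℝ) (hw : ∀ n, 0 < w n) (hw' : ∀ n, w n ≤ 2 * n + m + 1)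
    (y : ℕ → ℂ) :
    ∑' n, ‖invLapSeq m y n‖ₑ ≤ (3 : ℝ≥0) * ∑' n, ‖y n‖ₑ * ENNReal.ofReal (1 / w n) := by
  have hm : (0 : ℝ) ≤ m := Nat.cast_nonneg m
  refine tsum_band_le _ (fun n => ‖y n‖ₑ * ENNReal.ofReal (1 / w n)) ?_ fun n => ?_
  · change ‖-(1 / (4 * (m + 1) * (m + 2)) : ℂ) * y 0
        + (1 / (4 * (2 + m) * (2 + m + 1)) : ℂ) * y 1‖ₑ ≤ _
    refine (enorm_add_le _ _).trans (add_le_add ?_ ?_)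
    · rw [neg_mul, enorm_neg]
      refine enorm_mul_le_of_real (1 / (4 * (m + 1) * (m + 2))) _ (by push_cast; rfl)
        (by positivity) (div_le_one_div_of (by positivity) (hw 0) ?_) _
      have := hw' 0
      push_cast at this
      nlinarith
    · refine enorm_mul_le_of_real (1 / (4 * (2 + m) * (2 + m + 1))) _ (by push_cast; rfl)
        (by positivity) (div_le_one_div_of (by positivity) (hw 1) ?_) _
      have := hw' 1
      push_cast at this
      nlinarith
  · have hn : (0 : ℝ) ≤ n := Nat.cast_nonneg n
    have hmn : (0 : ℝ) ≤ m * n := mul_nonneg hm hn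
    change ‖(1 / (4 * (2 * n + m + 1) * (2 * n + m + 2)) : ℂ) * y n
        - (1 / (2 * (2 * (n + 1) + m + 2) * (2 * (n + 1) + m)) : ℂ) * y (n + 1)
        + (1 / (4 * (2 * (n + 2) + m) * (2 * (n + 2) + m + 1)) : ℂ) * y (n + 2)‖ₑ ≤ _
    refine (enorm_add_le _ _).trans (add_le_add (enorm_sub_le.trans (add_le_add ?_ ?_)) ?_)
    · refine enorm_mul_le_of_real (1 / (4 * (2 * n + m + 1) * (2 * n + m + 2))) _
        (by push_cast; rfl) (by positivity) (div_le_one_div_of (by positivity) (hw _) ?_) _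
      have := hw' n
      nlinarith
    · refine enorm_mul_le_of_real (1 / (2 * (2 * (n + 1) + m + 2) * (2 * (n + 1) + m))) _
        (by push_cast; rfl) (by positivity) (div_le_one_div_of (by positivity) (hw _) ?_) _
      have := hw' (n + 1)
      push_cast at this
      nlinarith
    · refine enorm_mul_le_of_real (1 / (4 * (2 * (n + 2) + m) * (2 * (n + 2) + m + 1))) _
        (by push_cast; rfl) (by positivity) (div_le_one_div_of (by positivity) (hw _) ?_) _
      have := hw' (n + 2)
      push_cast at this
      nlinarith

theorem invLapSeq_bounded (m : ℕ) :
    ∃ C : ℝ≥0, ∀ x : V, ∑' n, ‖(invLapSeq m ∘ₗ toSeq) x n‖ₑ ≤ C * ∑' n, ‖x n‖ₑ := by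
  refine ⟨3, fun x => (invLapSeq_bound m (fun _ => 1) (fun _ => one_pos) (fun n => ?_) x).trans ?_⟩
  · have h1 : (0 : ℝ) ≤ n := Nat.cast_nonneg n
    have h2 : (0 : ℝ) ≤ m := Nat.cast_nonneg m
    linarith
  · simp

theorem invLap_invRplus_bounded :
    ∃ C : ℝ≥0, ∀ x : V, ∑' n, ‖(invLapSeq 1 ∘ₗ invRplusSeq) x n‖ₑ ≤ C * ∑' n, ‖x n‖ₑ := by
  refine ⟨3, fun x => (invLapSeq_bound 1 (fun n => 2 * n + 2) (fun n => by positivity)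
    (fun n => by push_cast; linarith) _).trans ?_⟩
  exact mul_le_mul_right (enorm_invRplusSeq_tsum_le x) _

/-- `R⁻ : V^{0,m} → V^{0,m-1}`, for `m ≥ 1`. -/
def Rminus (m : ℕ) : V →L[ℂ] V := ofBounded (RminusSeq m ∘ₗ toSeq) (RminusSeq_bounded m)

/-- `(R⁻)^j : V^{0,m+j} → V^{0,m}`. -/
def RminusPow (m : ℕ) : ℕ → (V →L[ℂ] V)
  | 0 => ContinuousLinearMap.id ℂ V
  | j + 1 => RminusPow m j ∘L Rminus (m + j + 1)

/-- The inverse Dirichlet Laplacian `Δ₀⁻¹ : V^{0,m} → V^{0,m}`. -/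
def invLap (m : ℕ) : V →L[ℂ] V := ofBounded (invLapSeq m ∘ₗ toSeq) (invLapSeq_bounded m)

/-- `Δ₀⁻¹ (R⁺_{0,1})⁻¹ : V^{0,2} → V^{0,1}`. -/
def invLapInvRplus : V →L[ℂ] V := ofBounded (invLapSeq 1 ∘ₗ invRplusSeq) invLap_invRplus_bounded

/-- The truncation `π^N`, which keeps the coefficients with `n ≤ N`. -/
def proj (N : ℕ) : V →L[ℂ] V :=
  ofBounded
    { toFun := fun x n => if n ≤ N then x n else 0
      map_add' := fun x y => by
        funext n; simp only [lp.coeFn_add, Pi.add_apply]; split_ifs <;> simp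
      map_smul' := fun c x => by
        funext n; simp only [lp.coeFn_smul, Pi.smul_apply, RingHom.id_apply]; split_ifs <;> simp }
    ⟨1, fun x => by
      rw [ENNReal.coe_one, one_mul]
      refine ENNReal.tsum_le_tsum fun n => ?_
      change ‖if n ≤ N then x n else 0‖ₑ ≤ _
      split_ifs <;> simp⟩

/-- The complementary projection `π^∞ = I - π^N`. -/
def projTail (N : ℕ) : V →L[ℂ] V := ContinuousLinearMap.id ℂ V - proj N

/-- The map `F_m : V^{0,|m|} → V^{0,|m|}` for `m ≥ 0`,
`F_m(U) = U + Δ₀⁻¹ (R⁻)^m G(U)`, and for `m = -1`, `F_{-1}(U) = U + Δ₀⁻¹ (R⁺_{0,1})⁻¹ G(U)`.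
(All negative integers are sent to the case `m = -1`.) -/
def F : ℤ → V → V
  | Int.ofNat m => fun U => U + invLap m (RminusPow m m (G m U))
  | Int.negSucc _ => fun U => U + invLapInvRplus (G 1 U)

end ZernikeDisk

end

namespace ZernikeDisk

/-! The nonlinearity is quadratic, so `DF(c) - DF(U₀)` sends `x` to `2 T((c - U₀) * x)`, where `T`
is the linear operator applied after `G`. Once `‖a * b‖ ≤ ‖a‖ ‖b‖` is known for the convolution, it
remains to show `2 ‖A T‖ ≤ Z₂`.

Submultiplicativity asks that the coefficients `d_k` in `Q_i^{0,m} Q_j^{0,m} = ∑ d_k Q_k^{0,2m}`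
have absolute sum at most 1. Since `Q_n(1) = 1` for all `n`, they sum to 1, and everything rests on
their being nonnegative (`radialZernike_mul_coeff_nonneg`). The source is an addition formula for
rotations acting on binary forms (`addition_formula`). It yields a polynomial in `t`, `addPoly`,
which has a closed form in terms of `P_n^{0,m}` (`eval_addPoly`). Its coefficients are nonnegative
multiples of kernels `φ_l(a) φ_l(b)`, and that of `t^n` is `Q_n(a) Q_n(b)`. The closed form turns
the linearization of a product of Jacobi polynomials into one for these polynomials. The coefficient
of `t^(i+j)` then shows that `∑ d_k Q_k(a) Q_k(b)` is a positive semidefinite kernel, and testing it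
against `Q_k` gives `d_k ≥ 0`. The same formula at `t = 1`, `a = b` gives `|Q_n| ≤ 1` on `[0,1]`,
which justifies integrating the double series term by term.

For `‖A T‖`, an operator norm on `ℓ¹` is the supremum of the column norms. The matrices are
explicit: banded for `Δ₀⁻¹` and `R⁻`, triangular for `(R⁺_{0,1})⁻¹`. For `m ≥ 0` the finite part
only sees indices up to `N + 1`, and the tail is a column sum of `Δ₀⁻¹`. For `m = -1` the columns
are infinitely many and full above the diagonal, so a coupling term from tail to head appears as
well. -/

/-! ### Jacobi polynomials in `ρ = r²`: Rodrigues formula and orthogonality. -/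

open Polynomial in
/-- The Jacobi polynomial `P_n^{0,m}` in the variable `ρ = (1 + x) / 2`. -/
noncomputable def jacP (m n : ℕ) : ℝ[X] :=
  ∑ s ∈ Finset.range (n + 1),
    C ((n.choose s : ℝ) * ((n + m).choose s : ℝ)) * ((X - C 1) ^ s * X ^ (n - s))

theorem radialZernike_eq (m n : ℕ) (r : ℝ) :
    radialZernike 0 m n r = r ^ m * (jacP m n).eval (r ^ 2) := by
  unfold radialZernike jacobi jacP
  rw [Polynomial.eval_finsetSum]
  congr 1
  refine Finset.sum_congr rfl fun s hs => ?_
  have hs' : s ≤ n := by simpa [Nat.lt_succ_iff] using hs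
  simp only [Polynomial.eval_mul, Polynomial.eval_C, Polynomial.eval_pow, Polynomial.eval_sub,
    Polynomial.eval_X]
  rw [add_zero, Nat.choose_symm hs', show (2 * r ^ 2 - 1 - 1) / 2 = r ^ 2 - 1 by ring,
    show (2 * r ^ 2 - 1 + 1) / 2 = r ^ 2 by ring]
  ring

theorem continuous_radialZernike (m n : ℕ) : Continuous (radialZernike 0 m n) := by
  have : radialZernike 0 m n = fun r => r ^ m * (jacP m n).eval (r ^ 2) :=
    funext (radialZernike_eq m n)
  rw [this]
  have h := (jacP m n).continuous
  fun_prop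

theorem radialZernike_one (m n : ℕ) : radialZernike 0 m n 1 = 1 := by
  rw [radialZernike_eq, jacP, Polynomial.eval_finsetSum, Finset.sum_eq_single 0]
  · simp
  · intro s _ hs
    simp [hs]
  · simp

-- Leibniz' rule applied to the product on the left reproduces the defining sum term by term; the
-- falling factorials combine to `n!` times a binomial.
open Polynomial in
theorem jacP_rodrigues (m n : ℕ) :
    derivative^[n] ((X - C 1) ^ n * X ^ (n + m) : ℝ[X]) = C (n.factorial : ℝ) * (X ^ m * jacP m n) := by
  rw [Polynomial.iterate_derivative_mul, jacP, Finset.mul_sum, Finset.mul_sum]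
  refine Finset.sum_congr rfl fun s hs => ?_
  have hs' : s ≤ n := by simpa [Nat.lt_succ_iff] using hs
  rw [Polynomial.iterate_derivative_X_sub_pow, Polynomial.iterate_derivative_X_pow_eq_smul,
    Nat.sub_sub_self hs', show n + m - s = m + (n - s) by omega, pow_add]
  have h1 : (n.descFactorial (n - s) * (n + m).descFactorial s : ℝ)
      = n.factorial * (n + m).choose s := by
    have e1 := Nat.descFactorial_eq_factorial_mul_choose (n + m) s
    have e2 := Nat.factorial_mul_descFactorial (Nat.sub_le n s)
    rw [Nat.sub_sub_self hs'] at e2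
    rw [e1, ← e2]
    push_cast
    ring
  have h2 : (C (n.descFactorial (n - s) : ℝ) * C ((n + m).descFactorial s : ℝ) : ℝ[X])
      = C (n.factorial : ℝ) * C ((n + m).choose s : ℝ) := by
    rw [← C_mul, ← C_mul, h1]
  rw [C_mul]
  simp only [nsmul_eq_mul, ← Polynomial.C_eq_natCast, Polynomial.smul_eq_C_mul]
  linear_combination (C (n.choose s : ℝ) * (X - C 1) ^ s * X ^ m * X ^ (n - s) : ℝ[X]) * h2

-- Integration by parts `n` times: the zeros of order `n` at 0 and 1 kill every boundary term.
open Polynomial in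
theorem integral_iterate_derivative_mul_eq_zero (n : ℕ) :
    ∀ p q : ℝ[X], X ^ n ∣ p → (X - C 1) ^ n ∣ p → derivative^[n] q = 0 →
      ∫ x in (0 : ℝ)..1, (derivative^[n] p).eval x * q.eval x = 0 := by
  induction n with
  | zero => intro p q _ _ hq; simp only [Function.iterate_zero, id] at hq; simp [hq]
  | succ n ih =>
    intro p q h0 h1 hq
    have hz : ∀ a : ℝ, (X - C a) ^ (n + 1) ∣ p → (derivative^[n] p).eval a = 0 := by
      intro a ha
      have := Polynomial.pow_sub_dvd_iterate_derivative_of_pow_dvd n ha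
      rw [Nat.add_sub_cancel_left, pow_one] at this
      exact Polynomial.dvd_iff_isRoot.mp this
    have e := intervalIntegral.integral_deriv_mul_eq_sub (a := 0) (b := 1)
      (u := fun x => (derivative^[n] p).eval x) (v := fun x => q.eval x)
      (u' := fun x => (derivative^[n + 1] p).eval x) (v' := fun x => (derivative q).eval x)
      (fun x _ => by rw [Function.iterate_succ_apply']; exact Polynomial.hasDerivAt _ x)
      (fun x _ => Polynomial.hasDerivAt _ x)
      ((Polynomial.continuous _).intervalIntegrable _ _)
      ((Polynomial.continuous _).intervalIntegrable _ _)
    change ∫ x in (0 : ℝ)..1, ((derivative^[n + 1] p).eval x * q.eval x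
      + (derivative^[n] p).eval x * (derivative q).eval x) = _ at e
    rw [hz 1 h1, hz 0 (by simpa using h0), intervalIntegral.integral_add
      (Continuous.intervalIntegrable (by fun_prop) _ _)
      (Continuous.intervalIntegrable (by fun_prop) _ _),
      ih p (derivative q) ((pow_dvd_pow _ n.le_succ).trans h0)
        ((pow_dvd_pow _ n.le_succ).trans h1)
        (by rwa [← Function.iterate_succ_apply])] at e
    simpa using e

open Polynomial in
theorem natDegree_jacP_le (m n : ℕ) : (jacP m n).natDegree ≤ n := by
  refine Polynomial.natDegree_sum_le_of_forall_le _ _ fun s hs => ?_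
  have hs' : s ≤ n := by simpa [Nat.lt_succ_iff] using hs
  refine (Polynomial.natDegree_C_mul_le _ _).trans ?_
  rw [Polynomial.natDegree_mul (pow_ne_zero _ (X_sub_C_ne_zero 1)) (pow_ne_zero _ X_ne_zero),
    natDegree_pow, natDegree_X_sub_C, natDegree_X_pow]
  omega

-- Each summand of `jacP` is a positive multiple of a monic polynomial of degree `n`, so no
-- cancellation occurs in the top degree.
open Polynomial in
theorem coeff_jacP_pos (m n : ℕ) : 0 < (jacP m n).coeff n := by
  rw [jacP, Polynomial.finsetSum_coeff]
  have key : ∀ s ∈ Finset.range (n + 1),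
      (C ((n.choose s : ℝ) * ((n + m).choose s : ℝ)) * ((X - C 1) ^ s * X ^ (n - s)) : ℝ[X]).coeff n
        = (n.choose s : ℝ) * ((n + m).choose s : ℝ) := by
    intro s hs
    have hs' : s ≤ n := by simpa [Nat.lt_succ_iff] using hs
    have hm : ((X - C 1) ^ s * X ^ (n - s) : ℝ[X]).Monic :=
      ((monic_X_sub_C 1).pow s).mul (monic_X_pow _)
    have hd : ((X - C 1) ^ s * X ^ (n - s) : ℝ[X]).natDegree = n := by
      rw [Polynomial.natDegree_mul (pow_ne_zero _ (X_sub_C_ne_zero 1)) (pow_ne_zero _ X_ne_zero),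
        natDegree_pow, natDegree_X_sub_C, natDegree_X_pow]
      omega
    have := hm.coeff_natDegree
    rw [hd] at this
    rw [Polynomial.coeff_C_mul, this, mul_one]
  rw [Finset.sum_congr rfl key]
  refine Finset.sum_pos (fun s hs => ?_) ⟨0, by simp⟩
  have hs' : s ≤ n := by simpa [Nat.lt_succ_iff] using hs
  have h1 := Nat.choose_pos hs'
  have h2 := Nat.choose_pos (show s ≤ n + m by omega)
  positivity

open Polynomial in
theorem exists_eq_sum_jacP (m K : ℕ) : ∀ p : ℝ[X], p.natDegree ≤ K →
    ∃ c : ℕ → ℝ, p = ∑ k ∈ Finset.range (K + 1), C (c k) * jacP m k := by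
  induction K with
  | zero =>
    intro p hp
    refine ⟨fun _ => p.coeff 0, ?_⟩
    rw [Polynomial.eq_C_of_natDegree_le_zero hp]
    simp [jacP]
  | succ K ih =>
    intro p hp
    have hl := coeff_jacP_pos m (K + 1)
    set a := p.coeff (K + 1) / (jacP m (K + 1)).coeff (K + 1) with ha
    have hq : (p - C a * jacP m (K + 1)).natDegree ≤ K := by
      rw [Polynomial.natDegree_le_iff_coeff_eq_zero]
      intro N hN
      rw [Polynomial.coeff_sub, Polynomial.coeff_C_mul]
      rcases eq_or_ne N (K + 1) with rfl | h
      · rw [ha, div_mul_cancel₀ _ hl.ne', sub_self]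
      · rw [Polynomial.coeff_eq_zero_of_natDegree_lt (by omega),
          Polynomial.coeff_eq_zero_of_natDegree_lt
            (lt_of_le_of_lt (natDegree_jacP_le m (K + 1)) (by omega))]
        simp
    obtain ⟨c, hc⟩ := ih _ hq
    refine ⟨fun k => if k = K + 1 then a else c k, ?_⟩
    simp only [Finset.sum_range_succ _ (K + 1), if_true]
    rw [← sub_eq_iff_eq_add, hc]
    refine Finset.sum_congr rfl fun k hk => ?_
    rw [if_neg]
    have := Finset.mem_range.mp hk
    omega

open Polynomial in
theorem integral_jacP_mul_eq_zero (m n : ℕ) (q : ℝ[X]) (hq : q.natDegree < n) :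
    ∫ x in (0 : ℝ)..1, (x ^ m * (jacP m n).eval x) * q.eval x = 0 := by
  have h := integral_iterate_derivative_mul_eq_zero n ((X - C 1) ^ n * X ^ (n + m)) q
    (Dvd.dvd.mul_left (pow_dvd_pow _ (by omega)) _) (dvd_mul_right _ _)
    (Polynomial.iterate_derivative_eq_zero hq)
  rw [jacP_rodrigues] at h
  simp only [Polynomial.eval_mul, Polynomial.eval_C, Polynomial.eval_pow, Polynomial.eval_X,
    mul_assoc, intervalIntegral.integral_const_mul] at h
  have := (mul_eq_zero.mp h).resolve_left (by positivity)
  simpa only [mul_assoc] using this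

theorem integral_sq_mul_self (f : ℝ → ℝ) (hf : Continuous f) :
    ∫ r in (0 : ℝ)..1, f (r ^ 2) * r = (∫ x in (0 : ℝ)..1, f x) / 2 := by
  have h := intervalIntegral.integral_comp_mul_deriv (a := 0) (b := 1) (f := fun r : ℝ => r ^ 2)
    (f' := fun r => 2 * r) (g := f) (fun x _ => by simpa using hasDerivAt_pow 2 x)
    (by fun_prop) hf
  simp only [Function.comp, one_pow, ne_eq, OfNat.ofNat_ne_zero, not_false_eq_true, zero_pow] at h
  have h2 : ∫ r in (0 : ℝ)..1, f (r ^ 2) * (2 * r) = 2 * ∫ r in (0 : ℝ)..1, f (r ^ 2) * r := by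
    rw [← intervalIntegral.integral_const_mul]
    refine intervalIntegral.integral_congr fun r _ => ?_
    ring
  rw [← h, h2]
  ring

theorem integral_radialZernike_mul (m n k : ℕ) (h : n ≠ k) :
    ∫ r in (0 : ℝ)..1, radialZernike 0 m n r * radialZernike 0 m k r * r = 0 := by
  wlog hlt : k < n generalizing n k
  · refine Eq.trans (intervalIntegral.integral_congr fun r _ => ?_) (this k n h.symm (by omega))
    ring
  have h1 := integral_sq_mul_self
    (fun x => (x ^ m * (jacP m n).eval x) * (jacP m k).eval x) (by
      have := (jacP m n).continuous
      have := (jacP m k).continuous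
      fun_prop)
  rw [integral_jacP_mul_eq_zero m n _ (lt_of_le_of_lt (natDegree_jacP_le m k) hlt)] at h1
  rw [zero_div] at h1
  refine Eq.trans (intervalIntegral.integral_congr fun r _ => ?_) h1
  simp only [radialZernike_eq]
  ring

theorem integral_radialZernike_sq_pos (m n : ℕ) :
    0 < ∫ r in (0 : ℝ)..1, radialZernike 0 m n r ^ 2 * r := by
  refine intervalIntegral.integral_pos one_pos ?_ (fun r hr => ?_) ⟨1, by simp, ?_⟩
  · exact (((continuous_radialZernike m n).pow 2).mul continuous_id).continuousOn
  · exact mul_nonneg (sq_nonneg _) hr.1.le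
  · simp [radialZernike_one]

/-! ### Rotations of binary forms and the addition formula. -/

open Polynomial in
theorem coeff_linear_pow {R : Type*} [CommRing R] (a b : R) (n k : ℕ) :
    ((C a + C b * X) ^ n).coeff k = (n.choose k : R) * a ^ (n - k) * b ^ k := by
  rw [add_comm, add_pow, Polynomial.finsetSum_coeff]
  have h : ∀ i ∈ Finset.range (n + 1),
      ((C b * X) ^ i * C a ^ (n - i) * (n.choose i : R[X])).coeff k
        = if i = k then (n.choose k : R) * a ^ (n - k) * b ^ k else 0 := by
    intro i _
    rw [mul_pow, ← C_pow, ← C_pow, ← C_eq_natCast,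
      show C (b ^ i) * X ^ i * C (a ^ (n - i)) * C (n.choose i : R)
        = C ((n.choose i : R) * a ^ (n - i) * b ^ i) * X ^ i by simp only [C_mul]; ring,
      Polynomial.coeff_C_mul_X_pow]
    by_cases hik : i = k
    · simp [hik]
    · rw [if_neg hik, if_neg (Ne.symm hik)]
  rw [Finset.sum_congr rfl h, Finset.sum_ite_eq']
  split_ifs with hk
  · rfl
  · rw [Nat.choose_eq_zero_of_lt (by simpa using hk)]
    simp

open Polynomial in
theorem coeff_linear_pow_mul {R : Type*} [CommRing R] (a b e f : R) (p q l : ℕ) :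
    ((C a + C b * X) ^ p * (C e + C f * X) ^ q).coeff l =
      ∑ x ∈ Finset.HasAntidiagonal.antidiagonal l, ((p.choose x.1 : R) * a ^ (p - x.1) * b ^ x.1) *
        ((q.choose x.2 : R) * e ^ (q - x.2) * f ^ x.2) := by
  rw [Polynomial.coeff_mul]
  simp only [coeff_linear_pow]

open Polynomial in
/-- Coefficients of the expansion of a product of powers of two linear forms. -/
noncomputable def linCoeff (a b e f : ℝ) (p q l : ℕ) : ℝ :=
  ((C a + C b * X) ^ p * (C e + C f * X) ^ q).coeff l

theorem linCoeff_eq (a b e f : ℝ) (p q l : ℕ) : linCoeff a b e f p q l =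
      ∑ x ∈ Finset.HasAntidiagonal.antidiagonal l, ((p.choose x.1 : ℝ) * a ^ (p - x.1) * b ^ x.1) *
        ((q.choose x.2 : ℝ) * e ^ (q - x.2) * f ^ x.2) :=
  coeff_linear_pow_mul a b e f p q l

-- Inserting an auxiliary variable next to `M` and evaluating it at 1 records the degree in `M`. A
-- general algebra is allowed because `L` and `M` will themselves be polynomials in `X`.
open Polynomial in
theorem linear_pow_mul_linear_pow {R : Type*} [CommRing R] [Algebra ℝ R] (a b e f : ℝ) (L M : R)
    (p q : ℕ) :
    (algebraMap ℝ R a * L + algebraMap ℝ R b * M) ^ p *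
        (algebraMap ℝ R e * L + algebraMap ℝ R f * M) ^ q
      = ∑ l ∈ Finset.range (p + q + 1),
          algebraMap ℝ R (linCoeff a b e f p q l) * (L ^ (p + q - l) * M ^ l) := by
  set P : R[X] := (C (algebraMap ℝ R a * L) + C (algebraMap ℝ R b * M) * X) ^ p *
    (C (algebraMap ℝ R e * L) + C (algebraMap ℝ R f * M) * X) ^ q with hP
  have hdeg : P.natDegree < p + q + 1 := by
    have h : ∀ (u v : R) (k : ℕ), ((C u + C v * X) ^ k).natDegree ≤ k := by
      intro u v k
      refine (natDegree_pow_le_of_le k (m := 1) ?_).trans (by simp)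
      rw [add_comm]
      exact natDegree_linear_le
    exact Nat.lt_succ_of_le ((natDegree_mul_le).trans (add_le_add (h _ _ _) (h _ _ _)))
  have h1 := Polynomial.eval_eq_sum_range' hdeg (1 : R)
  rw [hP] at h1
  simp only [eval_mul, eval_pow, eval_add, eval_C, eval_X, mul_one, one_pow] at h1
  rw [h1]
  refine Finset.sum_congr rfl fun l _ => ?_
  rw [coeff_linear_pow_mul, linCoeff_eq, map_sum, Finset.sum_mul]
  refine Finset.sum_congr rfl fun x hx => ?_
  have hx' := Finset.HasAntidiagonal.mem_antidiagonal.mp hx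
  rcases lt_or_ge p x.1 with h | h
  · simp [Nat.choose_eq_zero_of_lt h]
  rcases lt_or_ge q x.2 with h' | h'
  · simp [Nat.choose_eq_zero_of_lt h']
  rw [show p + q - l = (p - x.1) + (q - x.2) by omega, ← hx']
  simp only [map_mul, map_pow, map_natCast, mul_pow, pow_add]
  ring

/-- The matrix coefficients of a rotation acting on binary forms, up to normalisation. -/
noncomputable def rotCoeff (p q l : ℕ) (c s : ℝ) : ℝ := linCoeff c (-s) s c p q l

/-- Both sides are the multinomial coefficient `(j+i'+i+k)! / (j! i! i'! k!)`. -/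
theorem choose_mul_choose_mul_choose (j i i' k : ℕ) :
    (((j + i' + i + k).choose (j + i') * (i + k).choose i * (j + i').choose j : ℕ) : ℝ) =
      ((j + i' + i + k).choose (j + i) * (i' + k).choose i' * (j + i).choose j : ℕ) := by
  have e1 : j + i' + i + k = (j + i') + (i + k) := by ring
  have e2 : (j + i' + i + k).choose (j + i) = ((j + i) + (i' + k)).choose (j + i) := by
    congr 1; ring
  rw [e2, e1]
  push_cast
  rw [Nat.cast_add_choose, Nat.cast_add_choose, Nat.cast_add_choose, Nat.cast_add_choose,
    Nat.cast_add_choose, Nat.cast_add_choose]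
  rw [show (j + i) + (i' + k) = (j + i') + (i + k) by ring]
  have h := Nat.factorial_ne_zero
  have h1 : ((j + i).factorial : ℝ) ≠ 0 := by exact_mod_cast h _
  have h2 : ((j + i').factorial : ℝ) ≠ 0 := by exact_mod_cast h _
  have h3 : ((i + k).factorial : ℝ) ≠ 0 := by exact_mod_cast h _
  have h4 : ((i' + k).factorial : ℝ) ≠ 0 := by exact_mod_cast h _
  field_simp

theorem sum_antidiagonal_eq_sum_range_min (g : ℕ → ℕ → ℝ) (q l : ℕ)
    (h : ∀ i j, l < j → g i j = 0) :
    ∑ x ∈ Finset.HasAntidiagonal.antidiagonal q, g x.1 x.2 = ∑ j ∈ Finset.range (min q l + 1), g (q - j) j := by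
  rw [← Finset.Nat.sum_antidiagonal_swap (f := fun x => g x.1 x.2)]
  simp only [Prod.fst_swap, Prod.snd_swap]
  rw [Finset.Nat.sum_antidiagonal_eq_sum_range_succ (fun j i => g i j)]
  symm
  refine Finset.sum_subset (Finset.range_mono (by omega)) fun j hj hj' => h _ _ ?_
  simp only [Finset.mem_range, not_lt] at hj hj'
  omega

/-- The action of a transposed rotation on forms is the transpose of the original action, up to the
binomial weights of the monomial basis. This makes both factors in the addition formula the same
function, hence the kernels positive semidefinite. -/
theorem linCoeff_rot_symm (p q l : ℕ) (hl : l ≤ p + q) (c s : ℝ) :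
    ((p + q).choose l : ℝ) * linCoeff c s (-s) c (p + q - l) l q
      = ((p + q).choose q : ℝ) * rotCoeff p q l c s := by
  -- Both sums are put over `j ≤ min q l`, where they agree term by term.
  rw [rotCoeff, linCoeff_eq, linCoeff_eq,
    sum_antidiagonal_eq_sum_range_min (fun i j =>
      ((p + q - l).choose i * c ^ (p + q - l - i) * s ^ i) * (l.choose j * (-s) ^ (l - j) * c ^ j))
      q l (fun i j h => by simp [Nat.choose_eq_zero_of_lt h]),
    sum_antidiagonal_eq_sum_range_min (fun i j =>
      (p.choose i * c ^ (p - i) * (-s) ^ i) * (q.choose j * s ^ (q - j) * c ^ j))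
      l q (fun i j h => by simp [Nat.choose_eq_zero_of_lt h]),
    min_comm, Finset.mul_sum, Finset.mul_sum]
  refine Finset.sum_congr rfl fun j hj => ?_
  rw [Finset.mem_range] at hj
  obtain ⟨i, rfl⟩ := Nat.exists_eq_add_of_le (show j ≤ q by omega)
  obtain ⟨i', rfl⟩ := Nat.exists_eq_add_of_le (show j ≤ l by omega)
  rw [Nat.add_sub_cancel_left, Nat.add_sub_cancel_left]
  rcases lt_or_ge p i' with h | h
  · rw [Nat.choose_eq_zero_of_lt h, Nat.choose_eq_zero_of_lt (show p + (j + i) - (j + i') < i by omega)]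
    simp
  · obtain ⟨k, rfl⟩ := Nat.exists_eq_add_of_le h
    rw [show i' + k + (j + i) - (j + i') = i + k by omega,
      show i' + k + (j + i) = j + i' + i + k by ring, Nat.add_sub_cancel_left,
      Nat.add_sub_cancel_left]
    have := choose_mul_choose_mul_choose j i i' k
    push_cast at this
    linear_combination (c ^ k * s ^ i * (-s) ^ i' * c ^ j) * this

/-- The homogeneous form of `jacP`. -/
noncomputable def jacHom (m n : ℕ) (x y : ℝ) : ℝ :=
  ∑ s ∈ Finset.range (n + 1), (n.choose s : ℝ) * ((n + m).choose s : ℝ) * (y ^ s * x ^ (n - s))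

theorem eval_jacP (m n : ℕ) (x : ℝ) : (jacP m n).eval x = jacHom m n x (x - 1) := by
  rw [jacP, jacHom, Polynomial.eval_finsetSum]
  simp

theorem jacHom_smul (m n : ℕ) (t x y : ℝ) : jacHom m n (t * x) (t * y) = t ^ n * jacHom m n x y := by
  rw [jacHom, jacHom, Finset.mul_sum]
  refine Finset.sum_congr rfl fun s hs => ?_
  have hs' : s ≤ n := by simpa [Nat.lt_succ_iff] using hs
  rw [mul_pow, mul_pow, ← Nat.add_sub_cancel' hs', pow_add, Nat.add_sub_cancel_left]
  ring

theorem linCoeff_diag (a b e f : ℝ) (m n : ℕ) :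
    linCoeff a b e f (n + m) n n = a ^ m * jacHom m n (a * f) (b * e) := by
  rw [linCoeff_eq, jacHom, Finset.Nat.sum_antidiagonal_eq_sum_range_succ (fun i j =>
    (((n + m).choose i : ℝ) * a ^ (n + m - i) * b ^ i) * ((n.choose j : ℝ) * e ^ (n - j) * f ^ j)),
    Finset.mul_sum]
  refine Finset.sum_congr rfl fun s hs => ?_
  have hs' : s ≤ n := by simpa [Nat.lt_succ_iff] using hs
  rw [Nat.choose_symm hs', Nat.sub_sub_self hs', show n + m - s = m + (n - s) by omega, pow_add,
    mul_pow, mul_pow]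
  ring

/-- Radial Zernike polynomials are the matrix coefficients of a rotation with both indices equal to
`n`; on the unit circle the second argument `-s²` of the homogeneous form is `c² - 1`. -/
theorem rotCoeff_diag (m n : ℕ) (c s : ℝ) (h : c ^ 2 + s ^ 2 = 1) :
    rotCoeff (n + m) n n c s = radialZernike 0 m n c := by
  rw [rotCoeff, linCoeff_diag, radialZernike_eq, eval_jacP]
  congr 2
  · ring
  · linarith

-- The four linear coefficients are the entries of a rotation by `(c', s')`, times `diag(1, t)`,
-- times a transposed rotation by `(c, s)`. Computing the action in two stages and inserting the
-- intermediate basis gives the sum over `l`; `diag(1, t)` contributes `t^l`.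
open Polynomial in
theorem addition_formula (p q : ℕ) (c s c' s' t : ℝ) :
    linCoeff (c' * c + s' * s * t) (c' * s - s' * c * t) (s' * c - c' * s * t)
        (s' * s + c' * c * t) p q q =
      ∑ l ∈ Finset.range (p + q + 1), ((p + q).choose q : ℝ) / ((p + q).choose l : ℝ) *
        rotCoeff p q l c' s' * rotCoeff p q l c s * t ^ l := by
  have h := linear_pow_mul_linear_pow (R := ℝ[X]) c' (-s' * t) s' (c' * t) (C c + C s * X)
    (C (-s) + C c * X) p q
  have e1 : algebraMap ℝ ℝ[X] c' * (C c + C s * X) + algebraMap ℝ ℝ[X] (-s' * t) *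
      (C (-s) + C c * X) = C (c' * c + s' * s * t) + C (c' * s - s' * c * t) * X := by
    simp only [algebraMap_eq, C_add, C_mul, C_sub, C_neg]; ring
  have e2 : algebraMap ℝ ℝ[X] s' * (C c + C s * X) + algebraMap ℝ ℝ[X] (c' * t) *
      (C (-s) + C c * X) = C (s' * c - c' * s * t) + C (s' * s + c' * c * t) * X := by
    simp only [algebraMap_eq, C_add, C_mul, C_sub, C_neg]; ring
  rw [e1, e2] at h
  have h' := congrArg (fun P => P.coeff q) h
  simp only [finsetSum_coeff, algebraMap_eq, coeff_C_mul] at h'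
  rw [linCoeff, h']
  refine Finset.sum_congr rfl fun l hl => ?_
  have hl' : l ≤ p + q := by simpa [Nat.lt_succ_iff] using hl
  have hs := linCoeff_rot_symm p q l hl' c s
  rw [linCoeff] at hs
  have hpos : ((p + q).choose l : ℝ) ≠ 0 := by exact_mod_cast (Nat.choose_pos hl').ne'
  have ht : linCoeff c' (-s' * t) s' (c' * t) p q l = rotCoeff p q l c' s' * t ^ l := by
    rw [rotCoeff, linCoeff_eq, linCoeff_eq, Finset.sum_mul]
    refine Finset.sum_congr rfl fun x hx => ?_
    rw [← Finset.HasAntidiagonal.mem_antidiagonal.mp hx, mul_pow, mul_pow, pow_add]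
    ring
  rw [ht]
  field_simp
  linear_combination (rotCoeff p q l c' s' * t ^ l) * hs

/-- The polynomial of the addition formula, whose coefficients are positive semidefinite kernels. -/
noncomputable def addPoly (m n : ℕ) (c s c' s' : ℝ) : Polynomial ℝ :=
  ∑ l ∈ Finset.range (n + m + n + 1), Polynomial.C (((n + m + n).choose n : ℝ) /
    ((n + m + n).choose l : ℝ) * rotCoeff (n + m) n l c' s' * rotCoeff (n + m) n l c s) *
      Polynomial.X ^ l

theorem coeff_addPoly (m n l : ℕ) (c s c' s' : ℝ) :
    (addPoly m n c s c' s').coeff l = if l ≤ n + m + n then ((n + m + n).choose n : ℝ) /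
    ((n + m + n).choose l : ℝ) * rotCoeff (n + m) n l c' s' * rotCoeff (n + m) n l c s else 0 := by
  rw [addPoly, Polynomial.finsetSum_coeff]
  simp only [Polynomial.coeff_C_mul_X_pow, Finset.sum_ite_eq, Finset.mem_range, Nat.lt_succ_iff]

theorem coeff_addPoly_self (m n : ℕ) (c s c' s' : ℝ) (h : c ^ 2 + s ^ 2 = 1)
    (h' : c' ^ 2 + s' ^ 2 = 1) :
    (addPoly m n c s c' s').coeff n = radialZernike 0 m n c' * radialZernike 0 m n c := by
  rw [coeff_addPoly, if_pos (by omega), rotCoeff_diag _ _ _ _ h, rotCoeff_diag _ _ _ _ h', div_self,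
    one_mul]
  exact_mod_cast (Nat.choose_pos (by omega)).ne'

/-- The composite matrix has determinant `t`, so the two arguments of `jacHom` differ by `t`;
dividing both by `t` makes them differ by 1, which is the inhomogeneous polynomial. -/
theorem eval_addPoly (m n : ℕ) (c s c' s' t : ℝ) (h : c ^ 2 + s ^ 2 = 1)
    (h' : c' ^ 2 + s' ^ 2 = 1) (ht : t ≠ 0) :
    (addPoly m n c s c' s').eval t = t ^ n * ((c' * c + s' * s * t) ^ m *
      (jacP m n).eval ((c' * c + s' * s * t) * (s' * s + c' * c * t) / t)) := by
  have e := addition_formula (n + m) n c s c' s' t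
  rw [addPoly, Polynomial.eval_finsetSum]
  simp only [Polynomial.eval_mul, Polynomial.eval_C, Polynomial.eval_pow, Polynomial.eval_X]
  rw [← e, linCoeff_diag, eval_jacP, mul_left_comm, ← jacHom_smul]
  congr 2
  · field_simp
  · field_simp
    linear_combination (-(t * (c' ^ 2 + s' ^ 2))) * h - t * h'

theorem abs_radialZernike_le_one (m n : ℕ) (r : ℝ) (h0 : 0 ≤ r) (h1 : r ≤ 1) :
    |radialZernike 0 m n r| ≤ 1 := by
  set s := Real.sqrt (1 - r ^ 2) with hs
  have h : r ^ 2 + s ^ 2 = 1 := by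
    rw [hs, Real.sq_sqrt (by nlinarith)]; ring
  -- For equal rotations and `t = 1` the composite is the identity, so the value is 1. It is a sum
  -- of nonnegative terms, one of which is `Q_n(r)²`.
  have e := eval_addPoly m n r s r s 1 h h one_ne_zero
  have e1 : r * r + s * s * 1 = 1 := by linarith
  have e2 : s * s + r * r * 1 = 1 := by linarith
  have e3 : (jacP m n).eval 1 = 1 := by
    have := radialZernike_eq m n 1
    rw [radialZernike_one] at this
    simpa using this.symm
  rw [e1, e2] at e
  simp only [one_pow, one_mul, div_one, e3] at e
  rw [Polynomial.eval_eq_sum_range' (n := n + m + n + 1) (by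
    rw [Nat.lt_succ_iff, Polynomial.natDegree_le_iff_coeff_eq_zero]
    intro N hN
    rw [coeff_addPoly, if_neg (by omega)])] at e
  have h2 := Finset.single_le_sum (f := fun l => (addPoly m n r s r s).coeff l * 1 ^ l)
    (s := Finset.range (n + m + n + 1)) (fun l _ => by
      simp only [coeff_addPoly, one_pow, mul_one]
      split_ifs
      · rw [mul_assoc]
        exact mul_nonneg (by positivity) (mul_self_nonneg _)
      · rfl) (Finset.mem_range.mpr (show n < n + m + n + 1 by omega))
  rw [e, coeff_addPoly_self m n r s r s h h, one_pow, mul_one] at h2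
  rw [← sq_le_one_iff_abs_le_one, sq]
  exact h2

/-! ### Nonnegative linearization of products. -/

theorem exists_radialZernike_mul (m i j : ℕ) : ∃ c : ℕ → ℝ,
    (jacP m i * jacP m j =
      ∑ k ∈ Finset.range (i + j + 1), Polynomial.C (c k) * jacP (m + m) k) ∧
    ∀ r, radialZernike 0 m i r * radialZernike 0 m j r =
      ∑ k ∈ Finset.range (i + j + 1), c k * radialZernike 0 (m + m) k r := by
  obtain ⟨c, hc⟩ := exists_eq_sum_jacP (m + m) (i + j) (jacP m i * jacP m j)
    (Polynomial.natDegree_mul_le.trans (add_le_add (natDegree_jacP_le m i) (natDegree_jacP_le m j)))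
  refine ⟨c, hc, fun r => ?_⟩
  have h := congrArg (Polynomial.eval (r ^ 2)) hc
  rw [Polynomial.eval_mul, Polynomial.eval_finsetSum] at h
  simp only [radialZernike_eq]
  rw [show r ^ m * (jacP m i).eval (r ^ 2) * (r ^ m * (jacP m j).eval (r ^ 2))
    = r ^ (m + m) * ((jacP m i).eval (r ^ 2) * (jacP m j).eval (r ^ 2)) by ring, h, Finset.mul_sum]
  refine Finset.sum_congr rfl fun k _ => ?_
  rw [Polynomial.eval_mul, Polynomial.eval_C]
  ring

theorem integral_sum_radialZernike_mul (m K : ℕ) (c : ℕ → ℝ) (k : ℕ) :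
    ∫ r in (0 : ℝ)..1, (∑ n ∈ Finset.range K, c n * radialZernike 0 m n r) *
        radialZernike 0 m k r * r
      = if k < K then c k * ∫ r in (0 : ℝ)..1, radialZernike 0 m k r ^ 2 * r else 0 := by
  have hc := continuous_radialZernike m
  simp only [Finset.sum_mul]
  rw [intervalIntegral.integral_finsetSum fun n _ =>
    Continuous.intervalIntegrable (by have := hc n; have := hc k; fun_prop) _ _]
  have h : ∀ n ∈ Finset.range K,
      ∫ r in (0 : ℝ)..1, c n * radialZernike 0 m n r * radialZernike 0 m k r * r
      = if n = k then c k * ∫ r in (0 : ℝ)..1, radialZernike 0 m k r ^ 2 * r else 0 := by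
    intro n _
    simp only [mul_assoc, intervalIntegral.integral_const_mul]
    split_ifs with hn
    · subst hn
      congr 1
      refine intervalIntegral.integral_congr fun r _ => ?_
      ring
    · have := integral_radialZernike_mul m n k hn
      simp only [mul_assoc] at this
      rw [this, mul_zero]
  rw [Finset.sum_congr rfl h, Finset.sum_ite_eq']
  simp only [Finset.mem_range]

/-- Integrate the kernel against `Q_k(a) Q_k(b)` with weight `a b`: orthogonality leaves `c_k H²` on
the left with `H > 0`, and the right becomes a nonnegative combination of squares. -/
theorem nonneg_of_kernel_eq {ι : Type*} (m K : ℕ) (c : ℕ → ℝ) (S : Finset ι) (w : ι → ℝ)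
    (f : ι → ℝ → ℝ) (hw : ∀ x ∈ S, 0 ≤ w x) (hf : ∀ x, Continuous (f x))
    (h : ∀ a ∈ Set.Icc (0 : ℝ) 1, ∀ b ∈ Set.Icc (0 : ℝ) 1,
      ∑ k ∈ Finset.range K, c k * (radialZernike 0 m k a * radialZernike 0 m k b)
        = ∑ x ∈ S, w x * (f x a * f x b)) (k : ℕ) (hk : k < K) : 0 ≤ c k := by
  have hc := continuous_radialZernike m
  have hH := integral_radialZernike_sq_pos m k
  set H := ∫ r in (0 : ℝ)..1, radialZernike 0 m k r ^ 2 * r with hHdef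
  have hS : ∀ v : ι → ℝ, ∫ r in (0 : ℝ)..1, (∑ x ∈ S, v x * f x r) * radialZernike 0 m k r * r
      = ∑ x ∈ S, v x * ∫ r in (0 : ℝ)..1, f x r * radialZernike 0 m k r * r := by
    intro v
    simp only [Finset.sum_mul]
    rw [intervalIntegral.integral_finsetSum fun n _ =>
      Continuous.intervalIntegrable (by have := hf n; have := hc k; fun_prop) _ _]
    simp only [mul_assoc, intervalIntegral.integral_const_mul]
  have step : ∀ a ∈ Set.Icc (0 : ℝ) 1, c k * radialZernike 0 m k a * H
      = ∑ x ∈ S, w x * f x a * ∫ r in (0 : ℝ)..1, f x r * radialZernike 0 m k r * r := by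
    intro a ha
    rw [← hS]
    have := integral_sum_radialZernike_mul m K (fun n => c n * radialZernike 0 m n a) k
    rw [if_pos hk] at this
    rw [← this]
    refine intervalIntegral.integral_congr fun b hb => ?_
    rw [Set.uIcc_of_le zero_le_one] at hb
    have e := h a ha b hb
    simp only [mul_assoc]
    rw [e]
  have e2 : c k * H * H
      = ∑ x ∈ S, w x * (∫ r in (0 : ℝ)..1, f x r * radialZernike 0 m k r * r) ^ 2 := by
    have h1 : ∫ a in (0 : ℝ)..1, (c k * radialZernike 0 m k a * H) * radialZernike 0 m k a * a
        = c k * H * H := by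
      refine Eq.trans (intervalIntegral.integral_congr fun r _ => ?_)
        (intervalIntegral.integral_const_mul (c k * H) fun r => radialZernike 0 m k r ^ 2 * r)
      ring
    rw [← h1]
    have h2 := hS (fun x => w x * ∫ r in (0 : ℝ)..1, f x r * radialZernike 0 m k r * r)
    rw [Finset.sum_congr rfl fun x _ => show _ = w x *
      (∫ r in (0 : ℝ)..1, f x r * radialZernike 0 m k r * r) *
      ∫ r in (0 : ℝ)..1, f x r * radialZernike 0 m k r * r by ring, ← h2]
    refine intervalIntegral.integral_congr fun a ha => ?_
    rw [Set.uIcc_of_le zero_le_one] at ha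
    rw [step a ha]
    congr 2
    refine Finset.sum_congr rfl fun x _ => ?_
    ring
  have h3 : 0 ≤ c k * H * H := by
    rw [e2]
    exact Finset.sum_nonneg fun x hx => mul_nonneg (hw x hx) (sq_nonneg _)
  by_contra hneg
  have : c k * H * H < 0 := mul_neg_of_neg_of_pos (mul_neg_of_neg_of_pos (by linarith) hH) hH
  linarith

/-- In the closed form, the argument of the Jacobi polynomial depends on neither `m` nor `n`, and
the prefactors multiply; the surplus power of `t` is `i + j - k`. -/
theorem addPoly_mul (m i j : ℕ) (d : ℕ → ℝ)
    (hd : jacP m i * jacP m j =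
      ∑ k ∈ Finset.range (i + j + 1), Polynomial.C (d k) * jacP (m + m) k)
    (c s c' s' : ℝ) (h : c ^ 2 + s ^ 2 = 1) (h' : c' ^ 2 + s' ^ 2 = 1) :
    addPoly m i c s c' s' * addPoly m j c s c' s' =
      ∑ k ∈ Finset.range (i + j + 1),
        Polynomial.C (d k) * (addPoly (m + m) k c s c' s' * Polynomial.X ^ (i + j - k)) := by
  -- The closed form divides by `t`, so the comparison is made away from 0.
  refine Polynomial.eq_of_infinite_eval_eq _ _ ((Set.finite_singleton (0 : ℝ)).infinite_compl.mono
    fun t ht => ?_)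
  have ht : t ≠ 0 := ht
  simp only [Set.mem_ofPred_eq, Polynomial.eval_mul, Polynomial.eval_finsetSum, Polynomial.eval_C,
    Polynomial.eval_pow, Polynomial.eval_X, eval_addPoly _ _ _ _ _ _ _ h h' ht]
  set y := (c' * c + s' * s * t) * (s' * s + c' * c * t) / t
  have e := congrArg (Polynomial.eval y) hd
  simp only [Polynomial.eval_mul, Polynomial.eval_finsetSum, Polynomial.eval_C] at e
  rw [show ∀ A B C D E : ℝ, A * (B * C) * (D * (B * E)) = A * D * (B * B) * (C * E) by
    intros; ring, e, Finset.mul_sum]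
  refine Finset.sum_congr rfl fun k hk => ?_
  have hk' : k ≤ i + j := by simpa [Nat.lt_succ_iff] using hk
  rw [← pow_add, ← pow_add, ← Nat.add_sub_cancel' hk', pow_add, Nat.add_sub_cancel_left]
  ring

theorem continuous_rotCoeff_sqrt (p q l : ℕ) :
    Continuous fun r : ℝ => rotCoeff p q l r (Real.sqrt (1 - r ^ 2)) := by
  simp only [rotCoeff, linCoeff_eq]
  fun_prop

theorem radialZernike_mul_coeff_nonneg (m i j : ℕ) (d : ℕ → ℝ)
    (hd : jacP m i * jacP m j =
      ∑ k ∈ Finset.range (i + j + 1), Polynomial.C (d k) * jacP (m + m) k)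
    (k : ℕ) (hk : k < i + j + 1) : 0 ≤ d k := by
  set w : ℕ → ℕ → ℝ := fun n l =>
    if l ≤ n + m + n then ((n + m + n).choose n : ℝ) / ((n + m + n).choose l : ℝ) else 0 with hw
  have hw0 : ∀ n l, 0 ≤ w n l := by
    intro n l
    simp only [hw]
    split_ifs <;> positivity
  set g : ℕ → ℕ → ℝ → ℝ := fun n l r => rotCoeff (n + m) n l r (Real.sqrt (1 - r ^ 2)) with hg
  refine nonneg_of_kernel_eq (m + m) (i + j + 1) d
    (Finset.HasAntidiagonal.antidiagonal (i + j)) (fun x => w i x.1 * w j x.2)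
    (fun x r => g i x.1 r * g j x.2 r)
    (fun x _ => mul_nonneg (hw0 _ _) (hw0 _ _))
    (fun x => (continuous_rotCoeff_sqrt _ _ _).mul (continuous_rotCoeff_sqrt _ _ _)) ?_ k hk
  intro a ha b hb
  have hcirc : ∀ r ∈ Set.Icc (0 : ℝ) 1, r ^ 2 + Real.sqrt (1 - r ^ 2) ^ 2 = 1 := by
    intro r hr
    rw [Real.sq_sqrt (by nlinarith [hr.1, hr.2])]
    ring
  -- In degree `i + j` the factor `X^(i+j-k)` selects the coefficient of index `k` of the `k`-th
  -- polynomial, which is `Q_k(a) Q_k(b)`; the other side is a sum of products of rank-one kernels.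
  have e := congrArg (fun P => P.coeff (i + j)) (addPoly_mul m i j d hd b _ a _ (hcirc b hb)
    (hcirc a ha))
  simp only [Polynomial.finsetSum_coeff, Polynomial.coeff_C_mul] at e
  rw [Polynomial.coeff_mul] at e
  have e1 : ∀ n l, (addPoly m n b (Real.sqrt (1 - b ^ 2)) a (Real.sqrt (1 - a ^ 2))).coeff l
      = w n l * (g n l a * g n l b) := by
    intro n l
    rw [coeff_addPoly]
    simp only [hw, hg]
    split_ifs
    · ring
    · ring
  simp only [e1] at e
  have e2 : ∀ k ∈ Finset.range (i + j + 1), d k *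
      (addPoly (m + m) k b (Real.sqrt (1 - b ^ 2)) a (Real.sqrt (1 - a ^ 2)) *
        Polynomial.X ^ (i + j - k)).coeff (i + j)
      = d k * (radialZernike 0 (m + m) k a * radialZernike 0 (m + m) k b) := by
    intro k hk
    have hk' : k ≤ i + j := by simpa [Nat.lt_succ_iff] using hk
    rw [Polynomial.coeff_mul_X_pow', if_pos (Nat.sub_le _ _), Nat.sub_sub_self hk',
      coeff_addPoly_self _ _ _ _ _ _ (hcirc b hb) (hcirc a ha)]
  rw [← Finset.sum_congr rfl e2, ← e]
  refine Finset.sum_congr rfl fun x _ => ?_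
  ring

/-- The linearization coefficients of the product of two radial Zernike polynomials. -/
noncomputable def linz (m i j k : ℕ) : ℝ :=
  (∫ r in (0 : ℝ)..1, radialZernike 0 m i r * radialZernike 0 m j r *
      radialZernike 0 (m + m) k r * r) /
    ∫ r in (0 : ℝ)..1, radialZernike 0 (m + m) k r ^ 2 * r

/-- The total is read off from the linearization at `r = 1`, where every radial polynomial is 1. -/
theorem linz_spec (m i j : ℕ) : (∀ k, 0 ≤ linz m i j k) ∧
    HasSum (linz m i j) 1 := by
  obtain ⟨c, hc, hc'⟩ := exists_radialZernike_mul m i j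
  have h : ∀ k, linz m i j k = if k < i + j + 1 then c k else 0 := by
    intro k
    simp only [linz, hc']
    rw [integral_sum_radialZernike_mul]
    split_ifs
    · exact mul_div_cancel_right₀ _ (integral_radialZernike_sq_pos _ _).ne'
    · simp
  refine ⟨fun k => ?_, ?_⟩
  · rw [h]
    split_ifs with hk
    · exact radialZernike_mul_coeff_nonneg m i j c hc k hk
    · rfl
  · have e : ∑ k ∈ Finset.range (i + j + 1), linz m i j k = 1 := by
      have := hc' 1
      simp only [radialZernike_one, mul_one] at this
      rw [this]
      exact Finset.sum_congr rfl fun k hk => by rw [h, if_pos (Finset.mem_range.mp hk)]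
    rw [← e]
    refine hasSum_sum_of_ne_finset_zero fun k hk => ?_
    rw [h, if_neg (by simpa using hk)]

/-! ### The convolution as a bounded bilinear map on `ℓ¹`. -/

theorem norm_V (x : V) : ‖x‖ = ∑' n, ‖x n‖ := by
  rw [lp.norm_eq_tsum_rpow (by simp)]
  simp

theorem enorm_V (x : V) : ∑' n, ‖x n‖ₑ = ENNReal.ofReal ‖x‖ := by
  rw [norm_V, ENNReal.ofReal_tsum_of_nonneg (fun _ => norm_nonneg _) (summable_norm_V x)]
  simp [ofReal_norm]

theorem linz_le_one (m i j k : ℕ) : linz m i j k ≤ 1 :=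
  le_hasSum (linz_spec m i j).2 k fun n _ => (linz_spec m i j).1 n

theorem summable_norm_mul (a b : V) : Summable fun p : ℕ × ℕ => ‖a p.1‖ * ‖b p.2‖ :=
  (summable_norm_V a).mul_of_nonneg (summable_norm_V b) (fun _ => norm_nonneg _)
    fun _ => norm_nonneg _

theorem norm_mul_linz_le (m k : ℕ) (a b : V) (p : ℕ × ℕ) :
    ‖a p.1 * b p.2 * (linz m p.1 p.2 k : ℂ)‖ ≤ ‖a p.1‖ * ‖b p.2‖ := by
  rw [norm_mul, norm_mul, Complex.norm_real, Real.norm_of_nonneg ((linz_spec m _ _).1 k)]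
  exact mul_le_of_le_one_right (by positivity) (linz_le_one _ _ _ _)

theorem summable_mul_linz (m k : ℕ) (a b : V) :
    Summable fun p : ℕ × ℕ => a p.1 * b p.2 * (linz m p.1 p.2 k : ℂ) :=
  Summable.of_norm_bounded (summable_norm_mul a b) (norm_mul_linz_le m k a b)

theorem norm_mul_radialZernike_le (m n : ℕ) (z : ℂ) (r : ℝ) (hr : r ∈ Set.Icc (0 : ℝ) 1) :
    ‖z * (radialZernike 0 m n r : ℂ)‖ ≤ ‖z‖ := by
  rw [norm_mul, Complex.norm_real]
  exact mul_le_of_le_one_right (norm_nonneg _) (abs_radialZernike_le_one m n r hr.1 hr.2)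

theorem hasSum_series_mul_series (m : ℕ) (a b : V) (r : ℝ) (hr : r ∈ Set.Icc (0 : ℝ) 1) :
    HasSum (fun p : ℕ × ℕ => (a p.1 * (radialZernike 0 m p.1 r : ℂ)) *
      (b p.2 * (radialZernike 0 m p.2 r : ℂ))) (series m a r * series m b r) := by
  have h : ∀ x : V, Summable fun n => ‖x n * (radialZernike 0 m n r : ℂ)‖ := fun x =>
    Summable.of_nonneg_of_le (fun _ => norm_nonneg _)
      (fun n => norm_mul_radialZernike_le m n _ r hr) (summable_norm_V x)
  rw [series, series, tsum_mul_tsum_of_summable_norm (h a) (h b)]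
  exact (summable_mul_of_summable_norm (h a) (h b)).hasSum

/-- Dominated convergence with majorant `‖a_i‖ ‖b_j‖`, available because `|Q_n| ≤ 1` on `[0,1]`. -/
theorem conv_eq_tsum (m : ℕ) (a b : V) (k : ℕ) :
    conv m m a b k = ∑' p : ℕ × ℕ, a p.1 * b p.2 * (linz m p.1 p.2 k : ℂ) := by
  have hc := continuous_radialZernike
  have hint : HasSum (fun p : ℕ × ℕ => ∫ r in (0 : ℝ)..1, (a p.1 * b p.2) *
      ((radialZernike 0 m p.1 r * radialZernike 0 m p.2 r * radialZernike 0 (m + m) k r * r : ℝ) : ℂ))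
      (∫ r in (0 : ℝ)..1, series m a r * series m b r * (radialZernike 0 (m + m) k r : ℂ) * (r : ℂ)) := by
    refine intervalIntegral.hasSum_integral_of_dominated_convergence
      (fun p _ => ‖a p.1‖ * ‖b p.2‖) (fun p => ?_) (fun p => ?_) ?_ ?_ ?_
    · have h1 := hc m p.1
      have h2 := hc m p.2
      have h3 := hc (m + m) k
      exact Continuous.aestronglyMeasurable (by fun_prop)
    · refine Filter.Eventually.of_forall fun r hr => ?_
      rw [Set.uIoc_of_le zero_le_one] at hr
      rw [norm_mul, norm_mul, Complex.norm_real, Real.norm_eq_abs, abs_mul, abs_mul, abs_mul]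
      refine mul_le_of_le_one_right (by positivity) ?_
      have hq := fun m n => abs_radialZernike_le_one m n r hr.1.le hr.2
      have hr1 : |r| ≤ 1 := abs_le.mpr ⟨by linarith [hr.1], hr.2⟩
      exact mul_le_one₀ (mul_le_one₀ (mul_le_one₀ (hq _ _) (abs_nonneg _) (hq _ _)) (abs_nonneg _)
        (hq _ _)) (abs_nonneg _) hr1
    · exact Filter.Eventually.of_forall fun r _ => summable_norm_mul a b
    · exact continuous_const.intervalIntegrable _ _
    · refine Filter.Eventually.of_forall fun r hr => ?_
      rw [Set.uIoc_of_le zero_le_one] at hr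
      have h := (hasSum_series_mul_series m a b r ⟨hr.1.le, hr.2⟩).mul_right
        ((radialZernike 0 (m + m) k r : ℂ) * (r : ℂ))
      rw [← mul_assoc] at h
      refine h.congr_fun fun p => ?_
      push_cast
      ring
  rw [conv, zernikeCoeff, ← hint.tsum_eq, ← tsum_div_const]
  refine tsum_congr fun p => ?_
  rw [intervalIntegral.integral_const_mul, intervalIntegral.integral_ofReal, linz]
  push_cast
  ring

theorem tsum_enorm_conv_le (m : ℕ) (a b : V) :
    ∑' k, ‖conv m m a b k‖ₑ ≤ (∑' n, ‖a n‖ₑ) * ∑' n, ‖b n‖ₑ := by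
  calc ∑' k, ‖conv m m a b k‖ₑ
      ≤ ∑' k, ∑' p : ℕ × ℕ, ‖a p.1‖ₑ * ‖b p.2‖ₑ * ENNReal.ofReal (linz m p.1 p.2 k) := by
        refine ENNReal.tsum_le_tsum fun k => ?_
        rw [conv_eq_tsum]
        refine enorm_tsum_le_tsum_enorm.trans (ENNReal.tsum_le_tsum fun p => ?_)
        rw [enorm_mul, enorm_mul, ← ofReal_norm (linz m p.1 p.2 k : ℂ), Complex.norm_real,
          Real.norm_of_nonneg ((linz_spec m _ _).1 k)]
    _ = ∑' p : ℕ × ℕ, ‖a p.1‖ₑ * ‖b p.2‖ₑ := by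
        rw [ENNReal.tsum_comm]
        refine tsum_congr fun p => ?_
        obtain ⟨h0, h1⟩ := linz_spec m p.1 p.2
        rw [ENNReal.tsum_mul_left, ← ENNReal.ofReal_tsum_of_nonneg h0 h1.summable, h1.tsum_eq,
          ENNReal.ofReal_one, mul_one]
    _ = (∑' n, ‖a n‖ₑ) * ∑' n, ‖b n‖ₑ := by
        refine (ENNReal.tsum_prod (f := fun i j => ‖a i‖ₑ * ‖b j‖ₑ)).trans ?_
        rw [← ENNReal.tsum_mul_right]
        simp only [ENNReal.tsum_mul_left]

theorem memℓp_conv (m : ℕ) (a b : V) : Memℓp (conv m m a b) 1 := by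
  have h : ∑' n, ‖conv m m a b n‖ₑ ≠ ⊤ := by
    refine ne_top_of_le_ne_top ?_ (tsum_enorm_conv_le m a b)
    rw [enorm_V, enorm_V]
    finiteness
  have h' := ENNReal.summable_toReal h
  refine memℓp_gen ?_
  simpa using h'

theorem norm_conv_le (m : ℕ) (a b : V) :
    ‖(⟨conv m m a b, memℓp_conv m a b⟩ : V)‖ ≤ ‖a‖ * ‖b‖ := by
  have h := tsum_enorm_conv_le m a b
  rw [enorm_V, enorm_V, ← ENNReal.ofReal_mul (norm_nonneg _)] at h
  have e := enorm_V ⟨conv m m a b, memℓp_conv m a b⟩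
  rw [← ENNReal.ofReal_le_ofReal_iff (by positivity), ← e]
  exact h

theorem conv_comm (m : ℕ) (a b : V) : conv m m a b = conv m m b a := by
  unfold conv
  simp only [mul_comm (series m a _)]

theorem conv_add_left (m : ℕ) (a a' b : V) :
    conv m m (a + a') b = conv m m a b + conv m m a' b := by
  funext k
  rw [Pi.add_apply, conv_eq_tsum, conv_eq_tsum, conv_eq_tsum,
    ← (summable_mul_linz m k a b).tsum_add (summable_mul_linz m k a' b)]
  refine tsum_congr fun p => ?_
  rw [lp.coeFn_add, Pi.add_apply]
  ring

theorem conv_smul_left (m : ℕ) (c : ℂ) (a b : V) : conv m m (c • a) b = c • conv m m a b := by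
  funext k
  rw [Pi.smul_apply, conv_eq_tsum, conv_eq_tsum, smul_eq_mul, ← tsum_mul_left]
  refine tsum_congr fun p => ?_
  rw [lp.coeFn_smul, Pi.smul_apply, smul_eq_mul]
  ring

/-- The discrete convolution as a bounded bilinear map. -/
noncomputable def convL (m : ℕ) : V →L[ℂ] V →L[ℂ] V :=
  LinearMap.mkContinuous₂
    (LinearMap.mk₂ ℂ (fun a b => (⟨conv m m a b, memℓp_conv m a b⟩ : V))
      (fun a a' b => Subtype.ext (conv_add_left m a a' b))
      (fun c a b => Subtype.ext (conv_smul_left m c a b))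
      (fun a b b' => Subtype.ext (by
        simp only [conv_comm m a, conv_add_left]
        rfl))
      (fun c a b => Subtype.ext (by
        simp only [conv_comm m a, conv_smul_left]
        rfl))) 1
    (fun a b => by rw [one_mul]; exact norm_conv_le m a b)

theorem norm_convL_apply_le (m : ℕ) (a b : V) : ‖convL m a b‖ ≤ ‖a‖ * ‖b‖ := norm_conv_le m a b

theorem convL_comm (m : ℕ) (a b : V) : convL m a b = convL m b a := Subtype.ext (conv_comm m a b)

theorem G_eq_convL (m : ℕ) (U : V) : G m U = convL m U U := dif_pos (memℓp_conv m U U)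

/-! ### The derivative of `U + T G(U)`, for both forms of `T` at once. -/

theorem hasFDerivAt_add_comp_G (m : ℕ) (T : V →L[ℂ] V) (c : V) :
    HasFDerivAt (fun U => U + T (G m U))
      (ContinuousLinearMap.id ℂ V + T ∘L ((2 : ℂ) • convL m c)) c := by
  have h1 : HasFDerivAt (fun U => convL m U U) ((2 : ℂ) • convL m c) c := by
    have h := (convL m).hasFDerivAt_of_bilinear (hasFDerivAt_id c) (hasFDerivAt_id c)
    refine h.congr_fderiv (ContinuousLinearMap.ext fun x => ?_)
    change convL m c x + convL m x c = (2 : ℂ) • convL m c x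
    rw [convL_comm m x c, two_smul]
  have h2 := (hasFDerivAt_id c).add (T.hasFDerivAt.comp c h1)
  refine h2.congr_of_eventuallyEq (Filter.Eventually.of_forall fun U => ?_)
  simp [G_eq_convL]

theorem norm_comp_fderiv_sub_le (m : ℕ) (T A : V →L[ℂ] V) (c U₀ : V) :
    ‖A ∘L (fderiv ℂ (fun U => U + T (G m U)) c - fderiv ℂ (fun U => U + T (G m U)) U₀)‖
      ≤ 2 * ‖A ∘L T‖ * ‖c - U₀‖ := by
  rw [(hasFDerivAt_add_comp_G m T c).fderiv, (hasFDerivAt_add_comp_G m T U₀).fderiv]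
  refine ContinuousLinearMap.opNorm_le_bound _ (by positivity) fun x => ?_
  have e : (A ∘L (ContinuousLinearMap.id ℂ V + T ∘L ((2 : ℂ) • convL m c) -
      (ContinuousLinearMap.id ℂ V + T ∘L ((2 : ℂ) • convL m U₀)))) x
      = (A ∘L T) ((2 : ℂ) • convL m (c - U₀) x) := by
    simp [smul_sub]
  rw [e]
  refine ((A ∘L T).le_opNorm _).trans ?_
  rw [norm_smul, show ‖(2 : ℂ)‖ = 2 by simp]
  calc ‖A ∘L T‖ * (2 * ‖convL m (c - U₀) x‖) ≤ ‖A ∘L T‖ * (2 * (‖c - U₀‖ * ‖x‖)) := by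
        gcongr; exact norm_convL_apply_le _ _ _
    _ = _ := by ring

/-! ### Column estimates for `m ≥ 0`. -/

/-- The unit vectors of `V`. -/
noncomputable def unitVec (j : ℕ) : V := lp.single 1 j (1 : ℂ)

theorem unitVec_apply (j n : ℕ) : unitVec j n = if n = j then 1 else 0 := by
  rw [unitVec, lp.single_apply, Pi.single_apply]

/-- On `ℓ¹` every vector is the convergent sum of its coordinates times unit vectors, so bounding
the columns suffices. -/
theorem opNorm_le_of_unitVec (T : V →L[ℂ] V) (C : ℝ) (hC : 0 ≤ C)
    (h : ∀ j, ‖T (unitVec j)‖ ≤ C) : ‖T‖ ≤ C := by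
  refine T.opNorm_le_bound hC fun x => ?_
  have h1 := (lp.hasSum_single (E := fun _ : ℕ => ℂ) (p := 1) ENNReal.one_ne_top x).mapL T
  have h2 : ∀ j, ‖T (lp.single 1 j (x j))‖ ≤ C * ‖x j‖ := by
    intro j
    have e : (lp.single 1 j (x j) : V) = x j • unitVec j := by
      rw [unitVec, ← lp.single_smul, smul_eq_mul, mul_one]
    rw [e, map_smul, norm_smul, mul_comm]
    exact mul_le_mul_of_nonneg_right (h j) (norm_nonneg _)
  rw [← h1.tsum_eq, norm_V x]
  exact tsum_of_norm_bounded ((summable_norm_V x).hasSum.mul_left C) h2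

theorem norm_eq_sum (y : V) (S : Finset ℕ) (h : ∀ n, n ∉ S → y n = 0) :
    ‖y‖ = ∑ n ∈ S, ‖y n‖ := by
  rw [norm_V, tsum_eq_sum fun n hn => by rw [h n hn, norm_zero]]

theorem norm_eq_of_eq_ofReal {z : ℂ} {x : ℝ} (h : z = x) (hx : 0 ≤ x) : ‖z‖ = x := by
  rw [h, Complex.norm_real, Real.norm_of_nonneg hx]

theorem proj_apply (N : ℕ) (x : V) (n : ℕ) : proj N x n = if n ≤ N then x n else 0 := rfl

theorem projTail_apply (N : ℕ) (x : V) (n : ℕ) : projTail N x n = if n ≤ N then 0 else x n := by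
  change x n - proj N x n = _
  rw [proj_apply]
  split_ifs <;> simp

theorem Rminus_zero (m : ℕ) (x : V) : Rminus m x 0 = (m / (m + 1) : ℂ) * x 0 := rfl

theorem Rminus_succ (m : ℕ) (x : V) (n : ℕ) : Rminus m x (n + 1) =
    ((n + 1) / (2 * n + m + 1) : ℂ) * x n
        + ((n + 1 + m) / (2 * (n + 1) + m + 1) : ℂ) * x (n + 1) := rfl

/-- Each column has two nonnegative entries, with numerators `j + m` and `j + 1` over `2j + m + 1`,
so it sums to 1. -/
theorem norm_Rminus_le (m : ℕ) : ‖Rminus m‖ ≤ 1 := by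
  refine opNorm_le_of_unitVec _ 1 zero_le_one fun j => ?_
  have h1 : Rminus m (unitVec j) j = (((j + m) / (2 * j + m + 1) : ℝ) : ℂ) := by
    cases j with
    | zero => rw [Rminus_zero, unitVec_apply, if_pos rfl]; push_cast; simp
    | succ j =>
      rw [Rminus_succ, unitVec_apply, unitVec_apply, if_neg (by omega), if_pos rfl]
      push_cast; simp
  have h2 : Rminus m (unitVec j) (j + 1) = (((j + 1) / (2 * j + m + 1) : ℝ) : ℂ) := by
    rw [Rminus_succ, unitVec_apply, unitVec_apply, if_pos rfl, if_neg (by omega)]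
    push_cast; simp
  rw [norm_eq_sum _ {j, j + 1}, Finset.sum_pair (by omega),
    norm_eq_of_eq_ofReal h1 (by positivity), norm_eq_of_eq_ofReal h2 (by positivity), ← add_div,
    div_le_one (by positivity)]
  · linarith
  · intro n hn
    simp only [Finset.mem_insert, Finset.mem_singleton, not_or] at hn
    cases n with
    | zero => rw [Rminus_zero, unitVec_apply, if_neg hn.1, mul_zero]
    | succ n =>
      rw [Rminus_succ, unitVec_apply, unitVec_apply, if_neg hn.1, if_neg (by omega)]
      simp

/-- Row `n` involves only the inputs `n - 1` and `n`, so powers of `R⁻` do not enlarge the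
truncation. The inverse Laplacian also uses input `n + 1`, whence `N + 1` in `proj_invLap`. -/
theorem proj_Rminus (m N : ℕ) : proj N ∘L Rminus m ∘L proj N = proj N ∘L Rminus m := by
  ext x n
  change proj N (Rminus m (proj N x)) n = proj N (Rminus m x) n
  rw [proj_apply, proj_apply]
  split_ifs with h
  · cases n with
    | zero => rw [Rminus_zero, Rminus_zero, proj_apply, if_pos h]
    | succ n =>
      rw [Rminus_succ, Rminus_succ, proj_apply, proj_apply, if_pos h, if_pos (by omega)]
  · rfl

theorem norm_RminusPow_le (m j : ℕ) : ‖RminusPow m j‖ ≤ 1 := by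
  induction j with
  | zero => exact ContinuousLinearMap.norm_id_le
  | succ j ih =>
    refine (ContinuousLinearMap.opNorm_comp_le _ _).trans ?_
    exact mul_le_one₀ ih (norm_nonneg _) (norm_Rminus_le _)

theorem proj_RminusPow (m j N : ℕ) :
    proj N ∘L RminusPow m j ∘L proj N = proj N ∘L RminusPow m j := by
  induction j with
  | zero =>
    ext x n
    change proj N (proj N x) n = proj N x n
    simp only [proj_apply]
    split_ifs <;> rfl
  | succ j ih =>
    have h := proj_Rminus (m + j + 1) N
    calc proj N ∘L RminusPow m (j + 1) ∘L proj N
        = (proj N ∘L RminusPow m j) ∘L (Rminus (m + j + 1) ∘L proj N) := rfl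
      _ = (proj N ∘L RminusPow m j) ∘L (proj N ∘L Rminus (m + j + 1) ∘L proj N) := by
        conv_lhs => rw [← ih]
        rfl
      _ = (proj N ∘L RminusPow m j ∘L proj N) ∘L Rminus (m + j + 1) := by
        rw [h]
        rfl
      _ = proj N ∘L RminusPow m (j + 1) := by
        rw [ih]
        rfl

theorem invLap_zero (m : ℕ) (x : V) : invLap m x 0 = -(1 / (4 * (m + 1) * (m + 2)) : ℂ) * x 0
        + (1 / (4 * (2 + m) * (2 + m + 1)) : ℂ) * x 1 := rfl

theorem invLap_succ (m : ℕ) (x : V) (n : ℕ) : invLap m x (n + 1) =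
    (1 / (4 * (2 * n + m + 1) * (2 * n + m + 2)) : ℂ) * x n
        - (1 / (2 * (2 * (n + 1) + m + 2) * (2 * (n + 1) + m)) : ℂ) * x (n + 1)
        + (1 / (4 * (2 * (n + 2) + m) * (2 * (n + 2) + m + 1)) : ℂ) * x (n + 2) := rfl

theorem proj_invLap (m N : ℕ) : proj N ∘L invLap m ∘L proj (N + 1) = proj N ∘L invLap m := by
  ext x n
  change proj N (invLap m (proj (N + 1) x)) n = proj N (invLap m x) n
  rw [proj_apply, proj_apply]
  split_ifs with h
  · cases n with
    | zero => rw [invLap_zero, invLap_zero, proj_apply, proj_apply, if_pos (by omega),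
        if_pos (by omega)]
    | succ n =>
      rw [invLap_succ, invLap_succ, proj_apply, proj_apply, proj_apply, if_pos (by omega),
        if_pos (by omega), if_pos (by omega)]
  · rfl

theorem norm_projTail_invLap_le (m N : ℕ) (hN : 1 ≤ N) :
    ‖projTail N ∘L invLap m‖ ≤ 1 / (2 * ((N : ℝ) + 1) + m) ^ 2 := by
  refine opNorm_le_of_unitVec _ _ (by positivity) fun j => ?_
  change ‖projTail N (invLap m (unitVec j))‖ ≤ _
  cases j with
  | zero =>
    -- Column 0 occupies rows 0 and 1 only, both cut off because `N ≥ 1`.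
    rw [norm_eq_sum _ ∅ fun n _ => ?_]
    · simp only [Finset.sum_empty]; positivity
    · rw [projTail_apply]
      split_ifs with h
      · rfl
      · obtain ⟨k, rfl⟩ := Nat.exists_eq_add_of_le (show 2 ≤ n by omega)
        rw [show 2 + k = (k + 1) + 1 by ring, invLap_succ, unitVec_apply, unitVec_apply,
          unitVec_apply, if_neg (by omega), if_neg (by omega), if_neg (by omega)]
        simp
  | succ j =>
    have h1 : invLap m (unitVec (j + 1)) j =
        ((1 / (4 * (2 * (j + 1) + m) * (2 * (j + 1) + m + 1)) : ℝ) : ℂ) := by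
      cases j with
      | zero =>
        rw [invLap_zero, unitVec_apply, unitVec_apply, if_neg (by omega), if_pos (by omega)]
        push_cast; simp
      | succ j =>
        rw [invLap_succ, unitVec_apply, unitVec_apply, unitVec_apply, if_neg (by omega),
          if_neg (by omega), if_pos (by omega)]
        push_cast; ring
    have h2 : -invLap m (unitVec (j + 1)) (j + 1) =
        ((1 / (2 * (2 * (j + 1) + m + 2) * (2 * (j + 1) + m)) : ℝ) : ℂ) := by
      rw [invLap_succ, unitVec_apply, unitVec_apply, unitVec_apply, if_neg (by omega),
          if_pos (by omega), if_neg (by omega)]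
      push_cast; ring
    have h3 : invLap m (unitVec (j + 1)) (j + 2) =
        ((1 / (4 * (2 * (j + 1) + m + 1) * (2 * (j + 1) + m + 2)) : ℝ) : ℂ) := by
      rw [show j + 2 = (j + 1) + 1 by ring, invLap_succ, unitVec_apply, unitVec_apply,
        unitVec_apply, if_pos (by omega), if_neg (by omega), if_neg (by omega)]
      push_cast; ring
    have n1 := norm_eq_of_eq_ofReal h1 (by positivity)
    have n2 := norm_eq_of_eq_ofReal h2 (by positivity)
    have n3 := norm_eq_of_eq_ofReal h3 (by positivity)
    rw [norm_neg] at n2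
    rw [norm_eq_sum _ {j, j + 1, j + 2}, Finset.sum_insert (by simp), Finset.sum_pair (by omega),
      projTail_apply, projTail_apply, projTail_apply]
    · have hm : (0 : ℝ) ≤ m := Nat.cast_nonneg m
      rcases lt_or_ge N (j + 1) with h | h
      · have hj : (N : ℝ) ≤ j := by exact_mod_cast Nat.lt_succ_iff.mp h
        have hN0 : (0 : ℝ) ≤ N := Nat.cast_nonneg N
        have b1 : ‖if j ≤ N then (0 : ℂ) else invLap m (unitVec (j + 1)) j‖
            ≤ 1 / (4 * (2 * (j + 1) + m) * (2 * (j + 1) + m + 1)) := by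
          split_ifs
          · rw [norm_zero]; positivity
          · exact n1.le
        rw [if_neg (show ¬j + 1 ≤ N by omega), if_neg (show ¬j + 2 ≤ N by omega), n2, n3]
        refine (add_le_add_left b1 _).trans ?_
        -- With `a = 2(j+1) + m`, the outer entries add up to `1/(2a(a+2))` by partial fractions,
        -- and the middle one has the same absolute value.
        calc _ = 1 / ((2 * ((j : ℝ) + 1) + m) * (2 * (j + 1) + m + 2)) := by
              field_simp
              ring
          _ ≤ _ := by
              refine one_div_le_one_div_of_le (by positivity) ?_
              rw [sq]
              exact mul_le_mul (by linarith) (by linarith) (by positivity) (by positivity)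
      · rw [if_pos (by omega), if_pos (by omega), norm_zero, zero_add, zero_add]
        split_ifs with h'
        · rw [norm_zero]; positivity
        -- The column of index `N` still reaches row `N + 1` through its lowest entry.
        · obtain rfl : N = j + 1 := by omega
          rw [n3]
          refine one_div_le_one_div_of_le (by positivity) ?_
          push_cast
          nlinarith [(Nat.cast_nonneg j : (0 : ℝ) ≤ j)]
    · intro n hn
      simp only [Finset.mem_insert, Finset.mem_singleton, not_or] at hn
      rw [projTail_apply]
      split_ifs with h
      · rfl
      · obtain ⟨k, rfl⟩ := Nat.exists_eq_add_of_le' (show 1 ≤ n by omega)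
        rw [invLap_succ, unitVec_apply, unitVec_apply, unitVec_apply, if_neg (by omega),
          if_neg (by omega), if_neg (by omega)]
        simp

theorem two_mul_norm_comp_invLap_le (m N : ℕ) (hN : 1 ≤ N) (AN : V →L[ℂ] V)
    (hAN : AN ∘L proj N = AN) :
    2 * ‖(AN + projTail N) ∘L (invLap m ∘L RminusPow m m)‖
      ≤ 2 * ‖AN ∘L invLap m ∘L RminusPow m m ∘L proj (N + 1)‖
        + 2 / (2 * ((N : ℝ) + 1) + m) ^ 2 := by
  have e : AN ∘L (invLap m ∘L RminusPow m m)
      = AN ∘L invLap m ∘L RminusPow m m ∘L proj (N + 1) := by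
    calc AN ∘L (invLap m ∘L RminusPow m m)
        = AN ∘L (proj N ∘L invLap m) ∘L RminusPow m m := by
          conv_lhs => rw [← hAN]
          rfl
      _ = (AN ∘L proj N) ∘L invLap m ∘L (proj (N + 1) ∘L RminusPow m m) := by
          rw [← proj_invLap]; rfl
      _ = (AN ∘L (proj N ∘L invLap m ∘L proj (N + 1))) ∘L RminusPow m m ∘L proj (N + 1) := by
          rw [← proj_RminusPow]; rfl
      _ = (AN ∘L proj N) ∘L invLap m ∘L RminusPow m m ∘L proj (N + 1) := by
          rw [proj_invLap]; rfl
      _ = _ := by rw [hAN]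
  rw [ContinuousLinearMap.add_comp, e]
  have h1 : ‖projTail N ∘L (invLap m ∘L RminusPow m m)‖ ≤ 1 / (2 * ((N : ℝ) + 1) + m) ^ 2 :=
    calc ‖(projTail N ∘L invLap m) ∘L RminusPow m m‖
        ≤ ‖projTail N ∘L invLap m‖ * ‖RminusPow m m‖ := ContinuousLinearMap.opNorm_comp_le _ _
      _ ≤ ‖projTail N ∘L invLap m‖ :=
          mul_le_of_le_one_right (norm_nonneg _) (norm_RminusPow_le _ _)
      _ ≤ _ := norm_projTail_invLap_le m N hN
  have h2 := norm_add_le (AN ∘L invLap m ∘L RminusPow m m ∘L proj (N + 1))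
    (projTail N ∘L (invLap m ∘L RminusPow m m))
  have e2 : 2 / (2 * ((N : ℝ) + 1) + m) ^ 2 = 2 * (1 / (2 * ((N : ℝ) + 1) + m) ^ 2) := by ring
  rw [e2]
  linarith

/-! ### Column estimates for `m = -1`. -/

theorem norm_invRplusSeq_unitVec (i j : ℕ) : ‖invRplusSeq (unitVec j) i‖
    = if i ≤ j then 2 * ((i : ℝ) + 1) ^ 2 / ((j + 1) * (j + 2)) else 0 := by
  have h : invRplusSeq (unitVec j) i = (invRplusEntry i j : ℂ) := by
    change ∑' k, (invRplusEntry i k : ℂ) * unitVec j k = _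
    rw [tsum_eq_single j fun k hk => by rw [unitVec_apply, if_neg hk, mul_zero], unitVec_apply,
      if_pos rfl, mul_one]
  rw [h, Complex.norm_real, invRplusEntry]
  split_ifs
  · rw [norm_mul, norm_pow, norm_neg, norm_one, one_pow, one_mul, Real.norm_of_nonneg (by positivity)]
  · simp

theorem norm_invLapSeq_one_zero_le (y : ℕ → ℂ) :
    ‖invLapSeq 1 y 0‖ ≤ 1 / 24 * ‖y 0‖ + 1 / 48 * ‖y 1‖ := by
  change ‖-(1 / (4 * ((1 : ℕ) + 1) * ((1 : ℕ) + 2)) : ℂ) * y 0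
        + (1 / (4 * (2 + (1 : ℕ)) * (2 + (1 : ℕ) + 1)) : ℂ) * y 1‖ ≤ _
  refine (norm_add_le _ _).trans (le_of_eq ?_)
  rw [norm_mul, norm_mul]
  norm_num

theorem norm_invLapSeq_one_succ_le (y : ℕ → ℂ) (n : ℕ) :
    ‖invLapSeq 1 y (n + 1)‖ ≤ 1 / (4 * (2 * n + 2) * (2 * n + 3)) * ‖y n‖
      + 1 / (2 * (2 * n + 5) * (2 * n + 3)) * ‖y (n + 1)‖
      + 1 / (4 * (2 * n + 5) * (2 * n + 6)) * ‖y (n + 2)‖ := by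
  change ‖(1 / (4 * (2 * n + (1 : ℕ) + 1) * (2 * n + (1 : ℕ) + 2)) : ℂ) * y n
        - (1 / (2 * (2 * (n + 1) + (1 : ℕ) + 2) * (2 * (n + 1) + (1 : ℕ))) : ℂ) * y (n + 1)
        + (1 / (4 * (2 * (n + 2) + (1 : ℕ)) * (2 * (n + 2) + (1 : ℕ) + 1)) : ℂ) * y (n + 2)‖ ≤ _
  refine (norm_add_le _ _).trans (add_le_add ((norm_sub_le _ _).trans (add_le_add ?_ ?_)) ?_)
  · rw [norm_mul, norm_eq_of_eq_ofReal (x := 1 / (4 * (2 * n + 2) * (2 * n + 3)))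
      (by push_cast; ring) (by positivity)]
  · rw [norm_mul, norm_eq_of_eq_ofReal (x := 1 / (2 * (2 * n + 5) * (2 * n + 3)))
      (by push_cast; ring) (by positivity)]
  · rw [norm_mul, norm_eq_of_eq_ofReal (x := 1 / (4 * (2 * n + 5) * (2 * n + 6)))
      (by push_cast; ring) (by positivity)]

theorem norm_invRplusSeq_unitVec_le (i j : ℕ) :
    ‖invRplusSeq (unitVec j) i‖ ≤ 2 * ((i : ℝ) + 1) ^ 2 / ((j + 1) * (j + 2)) := by
  rw [norm_invRplusSeq_unitVec]
  split_ifs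
  · rfl
  · positivity

theorem norm_invLapInvRplus_zero_le (j : ℕ) :
    ‖invLapInvRplus (unitVec j) 0‖ ≤ 1 / (4 * (((j : ℝ) + 1) * (j + 2))) := by
  refine (norm_invLapSeq_one_zero_le _).trans ?_
  have h0 := norm_invRplusSeq_unitVec_le 0 j
  have h1 := norm_invRplusSeq_unitVec_le 1 j
  have e : 1 / (4 * (((j : ℝ) + 1) * (j + 2))) = 1 / 24 * (2 * (((0 : ℕ) : ℝ) + 1) ^ 2 / ((j + 1) * (j + 2)))
      + 1 / 48 * (2 * (((1 : ℕ) : ℝ) + 1) ^ 2 / ((j + 1) * (j + 2))) := by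
    field_simp
    norm_num
  rw [e]
  gcongr

/-- The quadratic growth in the row of `(R⁺)⁻¹` balances the quadratic decay of `Δ₀⁻¹`: the three
bounds add up exactly to a value independent of `n`. -/
theorem norm_invLapInvRplus_succ_le (n j : ℕ) :
    ‖invLapInvRplus (unitVec j) (n + 1)‖ ≤ 1 / (2 * (((j : ℝ) + 1) * (j + 2))) := by
  refine (norm_invLapSeq_one_succ_le _ n).trans ?_
  have h0 := norm_invRplusSeq_unitVec_le n j
  have h1 := norm_invRplusSeq_unitVec_le (n + 1) j
  have h2 := norm_invRplusSeq_unitVec_le (n + 2) j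
  have e : 1 / (2 * (((j : ℝ) + 1) * (j + 2))) =
      1 / (4 * (2 * n + 2) * (2 * n + 3)) * (2 * ((n : ℝ) + 1) ^ 2 / ((j + 1) * (j + 2)))
      + 1 / (2 * (2 * n + 5) * (2 * n + 3)) * (2 * (((n + 1 : ℕ) : ℝ) + 1) ^ 2 / ((j + 1) * (j + 2)))
      + 1 / (4 * (2 * n + 5) * (2 * n + 6)) * (2 * (((n + 2 : ℕ) : ℝ) + 1) ^ 2 / ((j + 1) * (j + 2))) := by
    push_cast
    field_simp
    ring
  rw [e]
  gcongr

/-- In the last nonzero row only one entry of the triangular column contributes, so the bound is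
smaller than the generic one. -/
theorem norm_invLapInvRplus_self_succ_le (j : ℕ) :
    ‖invLapInvRplus (unitVec j) (j + 1)‖ ≤ 1 / (4 * ((j : ℝ) + 2) * (2 * j + 3)) := by
  refine (norm_invLapSeq_one_succ_le _ j).trans (le_of_eq ?_)
  change _ * ‖invRplusSeq (unitVec j) j‖ + _ * ‖invRplusSeq (unitVec j) (j + 1)‖
    + _ * ‖invRplusSeq (unitVec j) (j + 2)‖ = _
  rw [norm_invRplusSeq_unitVec, norm_invRplusSeq_unitVec, norm_invRplusSeq_unitVec, if_pos le_rfl,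
    if_neg (by omega), if_neg (by omega)]
  field_simp
  ring

theorem invLapInvRplus_eq_zero (j n : ℕ) (h : j + 1 < n) : invLapInvRplus (unitVec j) n = 0 := by
  obtain ⟨k, rfl⟩ := Nat.exists_eq_add_of_le' (show 1 ≤ n by omega)
  rw [← norm_le_zero_iff]
  refine (norm_invLapSeq_one_succ_le _ k).trans (le_of_eq ?_)
  change _ * ‖invRplusSeq (unitVec j) k‖ + _ * ‖invRplusSeq (unitVec j) (k + 1)‖
    + _ * ‖invRplusSeq (unitVec j) (k + 2)‖ = _
  rw [norm_invRplusSeq_unitVec, norm_invRplusSeq_unitVec, norm_invRplusSeq_unitVec,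
    if_neg (by omega), if_neg (by omega), if_neg (by omega)]
  simp

theorem norm_proj_invLapInvRplus_projTail_le (N : ℕ) :
    ‖proj N ∘L invLapInvRplus ∘L projTail N‖ ≤ 8 / (15 * ((N : ℝ) + 3)) := by
  refine opNorm_le_of_unitVec _ _ (by positivity) fun j => ?_
  change ‖proj N (invLapInvRplus (projTail N (unitVec j)))‖ ≤ _
  rcases le_or_gt j N with h | h
  · have e : projTail N (unitVec j) = 0 := by
      ext n
      rw [projTail_apply, unitVec_apply]
      split_ifs
      · rfl
      · omega
      · rfl
    rw [e, map_zero, map_zero, norm_zero]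
    positivity
  · have e : projTail N (unitVec j) = unitVec j := by
      ext n
      rw [projTail_apply, unitVec_apply]
      split_ifs
      · omega
      · rfl
      · rfl
      · rfl
    rw [e, norm_eq_sum _ (Finset.range (N + 1)) fun n hn => by
      rw [proj_apply, if_neg (by simpa [Nat.lt_succ_iff] using hn)], Finset.sum_range_succ']
    have hj : (N : ℝ) + 1 ≤ j := by exact_mod_cast h
    have hN : (0 : ℝ) ≤ N := Nat.cast_nonneg N
    have h1 : ∑ n ∈ Finset.range N, ‖proj N (invLapInvRplus (unitVec j)) (n + 1)‖
        ≤ N * (1 / (2 * (((j : ℝ) + 1) * (j + 2)))) := by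
      refine (Finset.sum_le_card_nsmul _ _ _ fun n hn => ?_).trans (by
        rw [Finset.card_range, nsmul_eq_mul])
      rw [proj_apply, if_pos (by have := Finset.mem_range.mp hn; omega)]
      exact norm_invLapInvRplus_succ_le n j
    have h2 : ‖proj N (invLapInvRplus (unitVec j)) 0‖ ≤ 1 / (4 * (((j : ℝ) + 1) * (j + 2))) := by
      rw [proj_apply, if_pos (Nat.zero_le _)]
      exact norm_invLapInvRplus_zero_le j
    refine (add_le_add h1 h2).trans ?_
    -- The `N` generic rows and row 0, which counts half; the worst column is `j = N + 1`. The final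
    -- comparison amounts to `15(2N+1) ≤ 32(N+2)`.
    calc _ = (2 * (N : ℝ) + 1) / (4 * (((j : ℝ) + 1) * (j + 2))) := by
          field_simp
          ring
      _ ≤ (2 * (N : ℝ) + 1) / (4 * (((N : ℝ) + 2) * (N + 3))) := by
          refine div_le_div_of_nonneg_left (by positivity) (by positivity) ?_
          exact mul_le_mul_of_nonneg_left (mul_le_mul (by linarith) (by linarith) (by positivity)
            (by positivity)) (by norm_num)
      _ ≤ _ := by
          rw [div_le_div_iff₀ (by positivity) (by positivity)]
          nlinarith

theorem norm_projTail_invLapInvRplus_le (N : ℕ) (hN : 1 ≤ N) :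
    ‖projTail N ∘L invLapInvRplus‖ ≤ 1 / (4 * (N : ℝ)) := by
  have hN' : (1 : ℝ) ≤ N := by exact_mod_cast hN
  refine opNorm_le_of_unitVec _ _ (by positivity) fun j => ?_
  change ‖projTail N (invLapInvRplus (unitVec j))‖ ≤ _
  have h0 : ∀ n, n ∉ Finset.Ico (N + 1) (j + 2) → projTail N (invLapInvRplus (unitVec j)) n = 0 := by
    intro n hn
    rw [projTail_apply]
    split_ifs with h
    · rfl
    · refine invLapInvRplus_eq_zero j n ?_
      simp only [Finset.mem_Ico, not_and, not_lt] at hn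
      exact hn (by omega)
  rw [norm_eq_sum _ _ h0]
  rcases lt_or_ge j N with h | h
  · rw [Finset.Ico_eq_empty (by omega), Finset.sum_empty]
    positivity
  · have hj : (N : ℝ) ≤ j := by exact_mod_cast h
    rw [Finset.sum_Ico_succ_top (by omega)]
    have h1 : ∑ n ∈ Finset.Ico (N + 1) (j + 1), ‖projTail N (invLapInvRplus (unitVec j)) n‖
        ≤ ((j : ℝ) - N) * (1 / (2 * (((j : ℝ) + 1) * (j + 2)))) := by
      refine (Finset.sum_le_card_nsmul _ _ (1 / (2 * (((j : ℝ) + 1) * (j + 2)))) fun n hn => ?_).trans (by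
        rw [Nat.card_Ico, nsmul_eq_mul, Nat.add_sub_add_right, Nat.cast_sub h])
      rw [Finset.mem_Ico] at hn
      obtain ⟨k, rfl⟩ := Nat.exists_eq_add_of_le' (show 1 ≤ n by omega)
      rw [projTail_apply, if_neg (by omega)]
      exact norm_invLapInvRplus_succ_le k j
    have h2 : ‖projTail N (invLapInvRplus (unitVec j)) (j + 1)‖
        ≤ 1 / (4 * ((j : ℝ) + 2) * (2 * j + 3)) := by
      rw [projTail_apply, if_neg (by omega)]
      exact norm_invLapInvRplus_self_succ_le j
    -- The estimate `4N(j - N) ≤ j²` is `(j - 2N)² ≥ 0`, so the critical columns are near `j = 2N`.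
    -- The last row gets the other half of `1/(4N)`.
    have h3 : ((j : ℝ) - N) * (1 / (2 * (((j : ℝ) + 1) * (j + 2)))) ≤ 1 / (8 * N) := by
      rw [mul_one_div, div_le_div_iff₀ (by positivity) (by positivity)]
      nlinarith [sq_nonneg ((j : ℝ) - 2 * N)]
    have h4 : 1 / (4 * ((j : ℝ) + 2) * (2 * j + 3)) ≤ 1 / (8 * N) := by
      rw [div_le_div_iff₀ (by positivity) (by positivity)]
      nlinarith
    refine (add_le_add h1 h2).trans ((add_le_add h3 h4).trans (le_of_eq ?_))
    field_simp
    norm_num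

/-- Every column of `T` reaches the head rows, so `AN T` is not determined by finitely many columns;
splitting the input by `proj N` and `projTail N` isolates the coupling term bounded through `‖AN‖`.
-/
theorem two_mul_norm_comp_invLapInvRplus_le (N : ℕ) (hN : 1 ≤ N) (AN : V →L[ℂ] V)
    (hAN : AN ∘L proj N = AN) :
    2 * ‖(AN + projTail N) ∘L invLapInvRplus‖
      ≤ 2 * ‖AN ∘L invLapInvRplus ∘L proj N‖
        + 16 / 15 * (‖AN‖ / ((N : ℝ) + 3)) + 1 / (2 * (N : ℝ)) := by
  have e : (AN + projTail N) ∘L invLapInvRplus = AN ∘L invLapInvRplus ∘L proj N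
      + AN ∘L (proj N ∘L invLapInvRplus ∘L projTail N) + projTail N ∘L invLapInvRplus := by
    have e1 : AN ∘L (proj N ∘L invLapInvRplus ∘L projTail N)
        = (AN ∘L proj N) ∘L invLapInvRplus ∘L projTail N := rfl
    rw [e1, hAN, ContinuousLinearMap.add_comp, projTail, ContinuousLinearMap.comp_sub,
      ContinuousLinearMap.comp_sub, ContinuousLinearMap.comp_id]
    abel
  rw [e]
  have h1 := norm_add₃_le (a := AN ∘L invLapInvRplus ∘L proj N)
    (b := AN ∘L (proj N ∘L invLapInvRplus ∘L projTail N)) (c := projTail N ∘L invLapInvRplus)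
  have h2 : ‖AN ∘L (proj N ∘L invLapInvRplus ∘L projTail N)‖ ≤ ‖AN‖ * (8 / (15 * ((N : ℝ) + 3))) :=
    (ContinuousLinearMap.opNorm_comp_le _ _).trans
      (mul_le_mul_of_nonneg_left (norm_proj_invLapInvRplus_projTail_le N) (norm_nonneg _))
  have h3 := norm_projTail_invLapInvRplus_le N hN
  have hN' : (N : ℝ) ≠ 0 := by exact_mod_cast (by omega : N ≠ 0)
  have e2 : 16 / 15 * (‖AN‖ / ((N : ℝ) + 3)) = 2 * (‖AN‖ * (8 / (15 * ((N : ℝ) + 3)))) := by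
    field_simp
    ring
  have e3 : 1 / (2 * (N : ℝ)) = 2 * (1 / (4 * (N : ℝ))) := by
    field_simp
    norm_num
  rw [e2, e3]
  linarith

/-! ### Conclusion. -/

theorem norm_comp_fderiv_sub_le_of_mem_closedBall (m : ℕ) (T A : V →L[ℂ] V) (Z r : ℝ)
    (c U₀ : V) (hZ : 2 * ‖A ∘L T‖ ≤ Z) (hc : c ∈ Metric.closedBall U₀ r) :
    ‖A ∘L (fderiv ℂ (fun U => U + T (G m U)) c - fderiv ℂ (fun U => U + T (G m U)) U₀)‖
      ≤ Z * r := by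
  rw [Metric.mem_closedBall, dist_eq_norm] at hc
  refine (norm_comp_fderiv_sub_le m T A c U₀).trans ?_
  exact mul_le_mul hZ hc (norm_nonneg _) (le_trans (by positivity) hZ)

theorem proj_comp_proj (N : ℕ) : proj N ∘L proj N = proj N := by
  ext x n
  change proj N (proj N x) n = proj N x n
  simp only [proj_apply]
  split_ifs <;> rfl

end ZernikeDisk

theorem mainTheorem6 (m : ℤ) (hm : -1 ≤ m) (N : ℕ) (hN : 1 ≤ N)
    (U₀ : ZernikeDisk.V)
    (AN : ZernikeDisk.V →L[ℂ] ZernikeDisk.V)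
    (hAN : AN = ZernikeDisk.proj N ∘L AN ∘L ZernikeDisk.proj N)
    (A : ZernikeDisk.V →L[ℂ] ZernikeDisk.V) (hA : A = AN + ZernikeDisk.projTail N)
    (Z₂ : ℝ)
    (hZnonneg : 0 ≤ m →
      2 * ‖AN ∘L ZernikeDisk.invLap m.toNat ∘L ZernikeDisk.RminusPow m.toNat m.toNat ∘L
            ZernikeDisk.proj (N + 1)‖
        + 2 / (2 * ((N : ℝ) + 1) + (m : ℝ)) ^ 2 ≤ Z₂)
    (hZneg : m = -1 →
      2 * ‖AN ∘L ZernikeDisk.invLapInvRplus ∘L ZernikeDisk.proj N‖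
        + 16 / 15 * (‖AN‖ / ((N : ℝ) + 3)) + 1 / (2 * (N : ℝ)) ≤ Z₂)
    (r : ℝ) :
    (∀ U : ZernikeDisk.V, Memℓp (ZernikeDisk.conv m.natAbs m.natAbs U U) 1) ∧
    Differentiable ℂ (ZernikeDisk.F m) ∧
    ∀ c ∈ Metric.closedBall U₀ r,
      ‖A ∘L (fderiv ℂ (ZernikeDisk.F m) c - fderiv ℂ (ZernikeDisk.F m) U₀)‖ ≤ Z₂ * r := by
  have hAN' : AN ∘L ZernikeDisk.proj N = AN := by
    conv_lhs => rw [hAN]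
    calc (ZernikeDisk.proj N ∘L AN ∘L ZernikeDisk.proj N) ∘L ZernikeDisk.proj N
        = ZernikeDisk.proj N ∘L AN ∘L (ZernikeDisk.proj N ∘L ZernikeDisk.proj N) := rfl
      _ = AN := by rw [ZernikeDisk.proj_comp_proj, ← hAN]
  refine ⟨fun U => ZernikeDisk.memℓp_conv _ U U, ?_⟩
  cases m with
  | ofNat m =>
    have hZ := hZnonneg (Int.natCast_nonneg m)
    have hb := ZernikeDisk.two_mul_norm_comp_invLap_le m N hN AN hAN'
    refine ⟨fun U => (ZernikeDisk.hasFDerivAt_add_comp_G m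
      (ZernikeDisk.invLap m ∘L ZernikeDisk.RminusPow m m) U).differentiableAt, fun c hc => ?_⟩
    refine ZernikeDisk.norm_comp_fderiv_sub_le_of_mem_closedBall m
      (ZernikeDisk.invLap m ∘L ZernikeDisk.RminusPow m m) A Z₂ r c U₀ ?_ hc
    rw [hA]
    refine hb.trans ?_
    simpa using hZ
  | negSucc k =>
    have hZ := hZneg (by omega)
    refine ⟨fun U => (ZernikeDisk.hasFDerivAt_add_comp_G 1
      ZernikeDisk.invLapInvRplus U).differentiableAt, fun c hc => ?_⟩
    refine ZernikeDisk.norm_comp_fderiv_sub_le_of_mem_closedBall 1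
      ZernikeDisk.invLapInvRplus A Z₂ r c U₀ ?_ hc
    rw [hA]
    exact (ZernikeDisk.two_mul_norm_comp_invLapInvRplus_le N hN AN hAN').trans hZ
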